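/- Let $n\in\mathbb N$. A *translater* in $\mathbb R^{n+1}$ is a smooth immersion $f:M\to\mathbb R^{n+1}$ of a smooth $n$-dimensional manifold $M$ without boundary (Hausdorff, second countable, not necessarily connected), complete for the induced Riemannian metric, which admits a smooth unit normal field $\nu$ such that $$H=-\langle \nu,e_{n+1}\rangle ,$$ where $H=\operatorname{div}_\Sigma\nu$ is the mean curvature (so that the mean curvature vector is $-H\nu$). Write $\Sigma$ for the immersed hypersurface and also for the measure on $\mathbb R^{n+1}$ that it induces, that is, the push-forward under $f$ of the Riemannian volume of the induced metric. For a Borel measure $\mu$ on $\mathbb R^{n+1}$, $x_0\in\mathbb R^{n+1}$ and $t_0>0$ put $$F_{x_0,t_0}(\mu)=\frac1{(4\pi t_0)^{n/2}}\int e^{-\frac{\|x-x_0\|^2}{4t_0}}\,d\mu(x)\in[0,\infty],\qquad \lambda(\mu)=\sup_{x_0\in\mathbb R^{n+1},\,t_0>0}F_{x_0,t_0}(\mu)$$ (the *entropy* of $\mu$). Let $\Sigma_1,\Sigma_2\subset\mathbb R^{n+1}$ be translaters with $\lambda(\Sigma_1)<\infty$ and $\lambda(\Sigma_2)<\infty$.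 Then $$\lambda(\Sigma_1+\Sigma_2)=\lambda(\Sigma_1)+\lambda(\Sigma_2),$$ where $\Sigma_1+\Sigma_2$ denotes the sum of the two induced measures. Moreover, for $i=1,2$, $$\lambda(\Sigma_i)=\lim_{\tau\to\infty}F_{0,1}\Big(\tfrac1\tau\Sigma_i-\tau e_{n+1}\Big),$$ where $\tfrac1\tau\Sigma_i-\tau e_{n+1}$ is the image of $\Sigma_i$ under $x\mapsto \tfrac1\tau x-\tau e_{n+1}$. -/

import Mathlib

open Filter Topology Set MeasureTheory
open scoped Manifold ContDiff

noncomputable section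

namespace TranslatingSoliton

/-- Euclidean space `ℝⁿ`, with the Euclidean norm and Lebesgue measure. -/
abbrev Euc (n : ℕ) : Type := EuclideanSpace ℝ (Fin n)

/-- The `i`-th standard basis vector. -/
def basisVec {n : ℕ} (i : Fin n) : Euc n := EuclideanSpace.single i 1

/-- The direction of translation `e_{n+1} ∈ ℝⁿ⁺¹`. -/
def eTop (n : ℕ) : Euc (n + 1) := basisVec (Fin.last n)

section Hypersurface

variable {n : ℕ} {M : Type*} [TopologicalSpace M] [ChartedSpace (Euc n) M]

/-- The differential at `p` of a map `f : M → ℝⁿ⁺¹`, with `T_p M` identified with `ℝⁿ` (through the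
preferred chart at `p`) and every tangent space of `ℝⁿ⁺¹` with `ℝⁿ⁺¹`. -/
def differential (f : M → Euc (n + 1)) (p : M) : Euc n →L[ℝ] Euc (n + 1) :=
  mfderiv (𝓡 n) 𝓘(ℝ, Euc (n + 1)) f p

/-- The Gram matrix `⟪L e_i, L e_j⟫`, the matrix of the pullback of the Euclidean inner product
by `L`. -/
def gramMatrix (L : Euc n →L[ℝ] Euc (n + 1)) : Matrix (Fin n) (Fin n) ℝ :=
  Matrix.of fun i j => inner ℝ (L (basisVec i)) (L (basisVec j))

/-- The matrix `⟪dν e_i, df e_j⟫` of the second fundamental form at `p` with respect to `ν`. -/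
def secondFundamentalMatrix (f ν : M → Euc (n + 1)) (p : M) : Matrix (Fin n) (Fin n) ℝ :=
  Matrix.of fun i j =>
    inner ℝ (differential ν p (basisVec i)) (differential f p (basisVec j))

/-- The mean curvature `H = div_Σ ν = ∑ gⁱʲ ⟪∂ᵢν, ∂ⱼf⟫` of the immersion `f` with respect to the unit
normal field `ν`. With this sign the mean curvature vector is `-H ν`, and the unit sphere has `H = n`
with respect to its outer normal. -/
def meanCurvature (f ν : M → Euc (n + 1)) (p : M) : ℝ :=
  ((gramMatrix (differential f p))⁻¹ * secondFundamentalMatrix f ν p).trace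

/-- `ν` is a smooth field of unit normals along `f`. -/
structure IsUnitNormal (f ν : M → Euc (n + 1)) : Prop where
  smooth : ContMDiff (𝓡 n) 𝓘(ℝ, Euc (n + 1)) ∞ ν
  norm_eq_one : ∀ p, ‖ν p‖ = 1
  orthogonal : ∀ p v, inner ℝ (ν p) (differential f p v) = 0

/-- The intrinsic (Riemannian) distance of `M` for the metric induced by `f`: the infimum of the
Euclidean lengths of `f ∘ γ` over the `C¹` paths `γ : [0, 1] → M` from `p` to `q` (it is infinite
if there is no such path). -/
def intrinsicEDist (f : M → Euc (n + 1)) (p q : M) : ENNReal :=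
  ⨅ (γ : ℝ → M) (_ : ContMDiffOn 𝓘(ℝ, ℝ) (𝓡 n) 1 γ (Icc 0 1)) (_ : γ 0 = p) (_ : γ 1 = q),
    ∫⁻ t in Icc (0 : ℝ) 1, ‖derivWithin (f ∘ γ) (Icc 0 1) t‖ₑ

/-- Completeness of the metric induced by `f`: every sequence that is Cauchy for the intrinsic
distance converges in `M`. -/
def IsCompleteImmersion (f : M → Euc (n + 1)) : Prop :=
  ∀ u : ℕ → M,
    (∀ ε : ENNReal, 0 < ε → ∃ N, ∀ i ≥ N, ∀ j ≥ N, intrinsicEDist f (u i) (u j) < ε) →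
    ∃ p, Tendsto u atTop (𝓝 p)

/-- A translater: a smooth, complete, immersed hypersurface `f : M → ℝⁿ⁺¹` with a smooth unit normal
field `ν` such that `H = -⟪ν, e_{n+1}⟫`. -/
structure IsTranslater (f : M → Euc (n + 1)) : Prop where
  smooth : ContMDiff (𝓡 n) 𝓘(ℝ, Euc (n + 1)) ∞ f
  immersion : ∀ p, Function.Injective (differential f p)
  complete : IsCompleteImmersion f
  soliton : ∃ ν : M → Euc (n + 1), IsUnitNormal f ν ∧
    ∀ p, meanCurvature f ν p = -inner ℝ (ν p) (eTop n)

/-- The Riemannian volume density `√det(g_ij)` of the metric induced by `f`, in the chart `φ`. -/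
def volumeDensity (f : M → Euc (n + 1)) (φ : OpenPartialHomeomorph M (Euc n)) (y : Euc n) : ℝ :=
  Real.sqrt (gramMatrix (fderiv ℝ (f ∘ φ.symm) y)).det

variable [MeasurableSpace M]

/-- The Riemannian volume measure of the metric induced by `f` on the domain of the chart `φ`, extended
by zero to `M`: it is `√det(g_ij) dy` in the coordinates `y`. -/
def chartVolume (f : M → Euc (n + 1)) (φ : OpenPartialHomeomorph M (Euc n)) : Measure M :=
  (((volume : Measure (Euc n)).restrict φ.target).withDensity
    fun y => ENNReal.ofReal (volumeDensity f φ y)).map φ.symm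

/-- The Riemannian volume measure on `M` of the metric induced by `f`. The measures `chartVolume f φ`
agree on the overlaps of the charts, and their least upper bound (in the lattice of measures) is the
measure that restricts to `chartVolume f φ` on the domain of each chart `φ`. -/
def riemannianVolume (f : M → Euc (n + 1)) : Measure M :=
  ⨆ φ ∈ atlas (Euc n) M, chartVolume f φ

/-- The measure on `ℝⁿ⁺¹` induced by the immersed hypersurface `f`: the area measure of its image,
counted with multiplicity. -/
def inducedMeasure (f : M → Euc (n + 1)) : Measure (Euc (n + 1)) :=
  (riemannianVolume f).map f

end Hypersurface

/-- The functional `F_{x₀,t₀}`, for the dimension `n`, of a measure on `ℝⁿ⁺¹`. -/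
def gaussianArea {n : ℕ} (x₀ : Euc (n + 1)) (t₀ : ℝ) (μ : Measure (Euc (n + 1))) : ENNReal :=
  ENNReal.ofReal (1 / (4 * Real.pi * t₀) ^ ((n : ℝ) / 2)) *
    ∫⁻ x, ENNReal.ofReal (Real.exp (-(‖x - x₀‖ ^ 2 / (4 * t₀)))) ∂μ

/-- The entropy `λ(μ) = sup F_{x₀,t₀}(μ)` over `x₀ ∈ ℝⁿ⁺¹` and `t₀ > 0`. -/
def entropy {n : ℕ} (μ : Measure (Euc (n + 1))) : ENNReal :=
  ⨆ (x₀ : Euc (n + 1)) (t₀ : ℝ) (_ : 0 < t₀), gaussianArea x₀ t₀ μ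

end TranslatingSoliton

end

/-! The mean curvature vector of a translater is `⟪ν, e⟫ ν`, the normal part of `e = e_{n+1}`, so
the translates `Σ + t e` move by mean curvature up to tangential motion. Huisken's monotonicity
formula for this flow says that `F_{x₁ + s e, s}(Σ)` is nondecreasing in `s > 0` for every `x₁`
(`gaussianArea_moving_mono`).

The limit as `s → ∞` does not depend on `x₁`: at scale `s` a bounded shift of the centre changes the
Gaussian by an error that, integrated, is a small multiple of the entropy (`gaussianArea_shift_le`).
Every pair `(x₀, t₀)` lies on the family with `x₁ = x₀ - t₀ e`, so the entropy is the limit of `F_{s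
e, s}(Σ)` (`tendsto_gaussianArea_entropy`). This argument uses only a measure of finite entropy with
the monotonicity property, which passes to sums. Since the same family computes all three entropies,
additivity follows from additivity of limits. Putting `s = τ²` and rescaling gives the limit
formula.

For monotonicity, let `K` be the moving Gaussian and `Z = (x - x₁ - s e) / (2s) + e`. The translater
equation gives `∂ₛ K = K ⟪ν, Z⟫² - div (K Z^T)` on `Σ` (`tangentialDiv_kernelField`), and the
divergence should integrate to zero. As `Σ` need not be compact, a cutoff of slope at most `ε` for
the intrinsic distance is inserted. It exists because Hopf–Rinow makes closed neighbourhoods of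
compact sets compact (`exists_cutoff`). The error is at most `ε ∫ |K Z|`
(`abs_integral_mul_tangentialDiv_le`), which finite entropy controls. Then `ε → 0` and compact sets
exhaust `M`. The cutoff is only Lipschitz, so the divergence theorem is proved in charts with
Rademacher's theorem and glued by a partition of unity. -/

noncomputable section

namespace TranslatingSoliton

/-! ### Orthogonal projection to the tangent space, and traces relative to an immersion. -/

section LinearAlgebra

variable {n : ℕ}

/-- The pseudo-inverse of an injective linear map `L : ℝⁿ → ℝⁿ⁺¹`: the preimage under `L` of the
orthogonal projection to the range of `L`. -/
def pinv (L : Euc n →L[ℝ] Euc (n + 1)) : Euc (n + 1) →ₗ[ℝ] Euc n where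
  toFun W := WithLp.toLp 2 ((gramMatrix L)⁻¹.mulVec fun j => inner ℝ (L (basisVec j)) W)
  map_add' W W' := by
    ext i
    simp only [inner_add_right, PiLp.add_apply, Matrix.mulVec, dotProduct, mul_add,
      Finset.sum_add_distrib]
  map_smul' c W := by
    ext i
    simp only [inner_smul_right, PiLp.smul_apply, Matrix.mulVec, dotProduct, Finset.mul_sum,
      smul_eq_mul, RingHom.id_apply]
    exact Finset.sum_congr rfl fun j _ => by ring

theorem sum_basisVec (v : Euc n) : ∑ j, v j • (basisVec j : Euc n) = v := by
  ext i
  simp [basisVec, Finset.sum_apply, Pi.single_apply]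

theorem gramMatrix_mulVec (L : Euc n →L[ℝ] Euc (n + 1)) (v : Euc n) (i : Fin n) :
    (gramMatrix L).mulVec v.ofLp i = inner ℝ (L (basisVec i)) (L v) := by
  conv_rhs => rw [← sum_basisVec v]
  simp [gramMatrix, Matrix.mulVec, dotProduct, inner_sum, inner_smul_right, mul_comm]

theorem gramMatrix_posDef {L : Euc n →L[ℝ] Euc (n + 1)} (hL : Function.Injective L) :
    (gramMatrix L).PosDef := by
  refine Matrix.PosDef.of_dotProduct_mulVec_pos ?_ ?_
  · ext i j
    simp [gramMatrix, real_inner_comm]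
  · intro x hx
    have h1 : star x ⬝ᵥ (gramMatrix L).mulVec x
        = inner ℝ (L (WithLp.toLp 2 x)) (L (WithLp.toLp 2 x)) := by
      have h2 : ∀ i, (gramMatrix L).mulVec x i =
        inner ℝ (L (basisVec i)) (L (WithLp.toLp 2 x)) := gramMatrix_mulVec L (WithLp.toLp 2 x)
      conv_rhs => enter [2]; rw [← sum_basisVec (WithLp.toLp 2 x)]
      simp only [dotProduct, h2, map_sum, sum_inner, map_smul, inner_smul_left]
      simp
    rw [h1, real_inner_self_eq_norm_sq]
    have : L (WithLp.toLp 2 x) ≠ 0 := by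
      intro h
      apply hx
      have := hL (h.trans (map_zero L).symm)
      simpa using this
    positivity

theorem gramMatrix_det_pos {L : Euc n →L[ℝ] Euc (n + 1)} (hL : Function.Injective L) :
    0 < (gramMatrix L).det :=
  (gramMatrix_posDef hL).det_pos

theorem inner_pinv {L : Euc n →L[ℝ] Euc (n + 1)} (hL : Function.Injective L) (W : Euc (n + 1))
    (v : Euc n) : inner ℝ (L v) (L (pinv L W)) = inner ℝ (L v) W := by
  have key : ∀ i, inner ℝ (L (basisVec i)) (L (pinv L W)) = inner ℝ (L (basisVec i)) W := by
    intro i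
    rw [← gramMatrix_mulVec]
    simp only [pinv, LinearMap.coe_mk, AddHom.coe_mk]
    rw [Matrix.mulVec_mulVec, Matrix.mul_nonsing_inv _ (gramMatrix_det_pos hL).ne'.isUnit]
    simp
  conv_lhs => rw [← sum_basisVec v]
  conv_rhs => rw [← sum_basisVec v]
  simp only [map_sum, map_smul, sum_inner, inner_smul_left, key]

/-- The normal equations have only one solution, because a vector of the range orthogonal to the
range is zero. Identities for `pinv`, such as its derivative below, are proved by checking these
equations. -/
theorem eq_pinv {L : Euc n →L[ℝ] Euc (n + 1)} (hL : Function.Injective L) {W : Euc (n + 1)}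
    {v : Euc n} (h : ∀ v', inner ℝ (L v') (L v) = inner ℝ (L v') W) : v = pinv L W := by
  apply hL
  rw [← sub_eq_zero, ← inner_self_eq_zero (𝕜 := ℝ)]
  rw [← map_sub, map_sub L, inner_sub_right]
  nth_rewrite 1 [← map_sub L]
  rw [h, map_sub L, ← map_sub L, inner_pinv hL]
  simp

theorem pinv_comp {L : Euc n →L[ℝ] Euc (n + 1)} (hL : Function.Injective L)
    (A : Euc n →L[ℝ] Euc n) (hA : Function.Bijective A) (W : Euc (n + 1)) :
    A (pinv (L.comp A) W) = pinv L W := by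
  apply eq_pinv hL
  intro v'
  obtain ⟨v, rfl⟩ := hA.2 v'
  exact inner_pinv (L := L.comp A) (hL.comp hA.1) W v

/-- Codimension one enters here: the range of `L` and `ν` together span `ℝⁿ⁺¹`, and the difference
of the two sides is orthogonal to both. -/
theorem apply_pinv {L : Euc n →L[ℝ] Euc (n + 1)} (hL : Function.Injective L) {ν : Euc (n + 1)}
    (h1 : ‖ν‖ = 1) (h2 : ∀ v, inner ℝ ν (L v) = 0) (W : Euc (n + 1)) :
    L (pinv L W) = W - (inner ℝ ν W : ℝ) • ν := by
  let T : (Euc n × ℝ) →ₗ[ℝ] Euc (n + 1) :=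
    (L : Euc n →ₗ[ℝ] Euc (n + 1)).coprod (LinearMap.toSpanSingleton ℝ _ ν)
  have hT : ∀ p, T p = L p.1 + p.2 • ν := fun p => by simp [T]
  have hν : inner ℝ ν ν = (1 : ℝ) := by rw [real_inner_self_eq_norm_sq, h1]; norm_num
  have inj : Function.Injective T := by
    rw [injective_iff_map_eq_zero]
    rintro ⟨v, c⟩ h
    rw [hT] at h
    have hc : c = 0 := by
      have := congrArg (fun x => inner ℝ ν x) h
      simpa [inner_add_right, h2, inner_smul_right, hν, h1] using this
    subst hc
    simp only [zero_smul, add_zero] at h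
    rw [hL (h.trans (map_zero L).symm)]
    rfl
  have surj : Function.Surjective T := by
    rw [← LinearMap.injective_iff_surjective_of_finrank_eq_finrank (by simp)]
    exact inj
  rw [← sub_eq_zero, ← inner_self_eq_zero (𝕜 := ℝ)]
  obtain ⟨⟨v, c⟩, hv⟩ := surj (L (pinv L W) - (W - (inner ℝ ν W : ℝ) • ν))
  nth_rewrite 1 [← hv]
  have h2' : ∀ v, inner ℝ (L v) ν = 0 := fun v => by rw [real_inner_comm, h2]
  simp only [hT, inner_add_left, inner_sub_right, inner_smul_left, inner_smul_right, h2, h2',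
    inner_pinv hL, hν]
  simp
  ring

theorem norm_apply_pinv_le {L : Euc n →L[ℝ] Euc (n + 1)} (hL : Function.Injective L)
    (W : Euc (n + 1)) : ‖L (pinv L W)‖ ≤ ‖W‖ := by
  have h := inner_pinv hL W (pinv L W)
  rw [real_inner_self_eq_norm_sq] at h
  have h3 := real_inner_le_norm (L (pinv L W)) W
  by_cases h0 : ‖L (pinv L W)‖ = 0
  · rw [h0]; positivity
  · have : 0 < ‖L (pinv L W)‖ := by positivity
    nlinarith

/-- The trace of `pinv L ∘ B`, i.e. `∑ gⁱʲ ⟪B eᵢ, L eⱼ⟫`. -/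
theorem trace_pinv_comp (L B : Euc n →L[ℝ] Euc (n + 1)) :
    LinearMap.trace ℝ _ (pinv L ∘ₗ (B : Euc n →ₗ[ℝ] Euc (n + 1))) =
      ((gramMatrix L)⁻¹ * Matrix.of fun i j =>
        inner ℝ (B (basisVec i)) (L (basisVec j))).trace := by
  rw [LinearMap.trace_eq_matrix_trace ℝ (EuclideanSpace.basisFun (Fin n) ℝ).toBasis]
  rw [← Matrix.trace_transpose ((gramMatrix L)⁻¹ * _), Matrix.transpose_mul]
  have hs : ((gramMatrix L)⁻¹).transpose = (gramMatrix L)⁻¹ := by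
    rw [Matrix.transpose_nonsing_inv]
    congr 1
    ext i j
    simp [gramMatrix, real_inner_comm]
  rw [hs, Matrix.trace_mul_comm]
  congr 1
  ext i j
  rw [LinearMap.toMatrix_apply]
  simp [pinv, Matrix.mul_apply, Matrix.mulVec, dotProduct, basisVec, real_inner_comm]

/-- Chart independence of the trace: a change of coordinates `A` conjugates the endomorphism `pinv L
∘ B`. -/
theorem trace_pinv_conj {L : Euc n →L[ℝ] Euc (n + 1)} (hL : Function.Injective L)
    (B : Euc n →L[ℝ] Euc (n + 1)) (A : Euc n →L[ℝ] Euc n) (hA : Function.Bijective A) :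
    LinearMap.trace ℝ _ (pinv (L.comp A) ∘ₗ ((B.comp A : Euc n →L[ℝ] Euc (n + 1)) :
        Euc n →ₗ[ℝ] Euc (n + 1))) =
      LinearMap.trace ℝ _ (pinv L ∘ₗ (B : Euc n →ₗ[ℝ] Euc (n + 1))) := by
  let e : Euc n ≃ₗ[ℝ] Euc n := LinearEquiv.ofBijective (A : Euc n →ₗ[ℝ] Euc n) hA
  have he : ∀ v, e v = A v := fun v => rfl
  rw [← LinearMap.trace_conj' (pinv (L.comp A) ∘ₗ ((B.comp A : Euc n →L[ℝ] Euc (n + 1)) :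
        Euc n →ₗ[ℝ] Euc (n + 1))) e]
  congr 1
  ext1 v
  rw [LinearEquiv.conj_apply_apply, he]
  simp only [LinearMap.comp_apply, ContinuousLinearMap.coe_coe, ContinuousLinearMap.comp_apply]
  rw [pinv_comp hL A hA, ← he, LinearEquiv.apply_symm_apply]

/-- The trace `∑ gⁱʲ ⟪B eᵢ, L eⱼ⟫` of `B` relative to the immersion `L`. -/
def tangentialTrace (L B : Euc n →L[ℝ] Euc (n + 1)) : ℝ :=
  LinearMap.trace ℝ _ (pinv L ∘ₗ (B : Euc n →ₗ[ℝ] Euc (n + 1)))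

theorem tangentialTrace_comp {L : Euc n →L[ℝ] Euc (n + 1)} (hL : Function.Injective L)
    (B : Euc n →L[ℝ] Euc (n + 1)) {A : Euc n →L[ℝ] Euc n} (hA : Function.Bijective A) :
    tangentialTrace (L.comp A) (B.comp A) = tangentialTrace L B :=
  trace_pinv_conj hL B A hA

/-- Jacobi's formula for the derivative of a determinant at an invertible matrix. -/
theorem hasDerivAt_det {A : ℝ → Matrix (Fin n) (Fin n) ℝ} {A' : Matrix (Fin n) (Fin n) ℝ} {t : ℝ}
    (hA : ∀ i j, HasDerivAt (fun s => A s i j) (A' i j) t) (hdet : (A t).det ≠ 0) :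
    HasDerivAt (fun s => (A s).det) ((A t).det * ((A t)⁻¹ * A').trace) t := by
  have h1 : HasDerivAt (fun s => (A s).det) (∑ i, ((A t).updateCol i (fun j => A' j i)).det) t := by
    have : ∀ σ : Equiv.Perm (Fin n), HasDerivAt
        (fun s => (Equiv.Perm.sign σ : ℝ) * ∏ i, A s (σ i) i)
        ((Equiv.Perm.sign σ : ℝ) * ∑ i, (∏ j ∈ Finset.univ.erase i, A t (σ j) j) • A' (σ i) i) t :=
      fun σ => (HasDerivAt.fun_finsetProd (fun i _ => hA (σ i) i)).const_mul _
    have h2 := HasDerivAt.fun_sum (u := Finset.univ) (fun σ _ => this σ)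
    simp only [Matrix.det_apply']
    refine h2.congr_deriv ?_
    symm
    rw [Finset.sum_comm]
    refine Finset.sum_congr rfl fun σ _ => ?_
    rw [Finset.mul_sum]
    refine Finset.sum_congr rfl fun i _ => ?_
    congr 1
    rw [← Finset.mul_prod_erase _ _ (Finset.mem_univ i), smul_eq_mul, mul_comm]
    congr 1
    · refine Finset.prod_congr rfl fun j hj => ?_
      rw [Matrix.updateCol_ne (Finset.ne_of_mem_erase hj)]
    · simp
  refine h1.congr_deriv ?_
  -- By Cramer's rule, replacing the `i`-th column by that of `A'` gives a diagonal entry of `adj(A)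
  -- A'`.
  have h3 : ∀ i, ((A t).updateCol i (fun j => A' j i)).det = ((A t).adjugate * A') i i := by
    intro i
    rw [← Matrix.cramer_apply, Matrix.cramer_eq_adjugate_mulVec]
    rfl
  simp only [h3]
  rw [Matrix.inv_def, Matrix.smul_mul, Matrix.trace_smul, Ring.inverse_eq_inv', smul_eq_mul,
    mul_inv_cancel_left₀ hdet]
  rfl

end LinearAlgebra

/-! ### Divergence of the tangential part of a field, in coordinates. -/

section Divergence

variable {n : ℕ}

/-- The area density `√det ⟪L eᵢ, L eⱼ⟫` of a linear map. -/
def areaDensity (L : Euc n →L[ℝ] Euc (n + 1)) : ℝ := Real.sqrt (gramMatrix L).det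

theorem two_le_infty : (2 : ℕ∞ω) ≤ ∞ :=
  WithTop.coe_le_coe.2 (le_top : (2 : ℕ∞) ≤ ⊤)

theorem contDiffAt_det {E : Type*} [NormedAddCommGroup E] [NormedSpace ℝ E] {k : ℕ∞ω} {m : ℕ}
    {A : E → Matrix (Fin m) (Fin m) ℝ} {y : E} (hA : ∀ i j, ContDiffAt ℝ k (fun z => A z i j) y) :
    ContDiffAt ℝ k (fun z => (A z).det) y := by
  simp only [Matrix.det_apply']
  exact ContDiffAt.sum fun σ _ => contDiffAt_const.mul (contDiffAt_prod fun i _ => hA _ _)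

theorem contDiffAt_inv_apply {E : Type*} [NormedAddCommGroup E] [NormedSpace ℝ E] {k : ℕ∞ω} {m : ℕ}
    {A : E → Matrix (Fin m) (Fin m) ℝ} {y : E} (hA : ∀ i j, ContDiffAt ℝ k (fun z => A z i j) y)
    (hdet : (A y).det ≠ 0) (i j : Fin m) : ContDiffAt ℝ k (fun z => (A z)⁻¹ i j) y := by
  simp only [Matrix.inv_def, Matrix.smul_apply, Matrix.adjugate_apply, Ring.inverse_eq_inv',
    smul_eq_mul]
  refine ((contDiffAt_det hA).inv hdet).mul (contDiffAt_det fun a b => ?_)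
  by_cases h : a = j
  · subst h
    simpa using contDiffAt_const
  · simpa [Matrix.updateRow_ne h] using hA a b

variable {L : Euc n → Euc n →L[ℝ] Euc (n + 1)} {y : Euc n} {k : ℕ∞ω}

theorem contDiffAt_gramMatrix (hL : ContDiffAt ℝ k L y) (i j : Fin n) :
    ContDiffAt ℝ k (fun z => gramMatrix (L z) i j) y :=
  (hL.clm_apply contDiffAt_const).inner ℝ (hL.clm_apply contDiffAt_const)

theorem contDiffAt_areaDensity (hL : ContDiffAt ℝ k L y) (hinj : Function.Injective (L y)) :
    ContDiffAt ℝ k (fun z => areaDensity (L z)) y :=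
  (contDiffAt_det (contDiffAt_gramMatrix hL)).sqrt (gramMatrix_det_pos hinj).ne'

theorem contDiffAt_pinv (hL : ContDiffAt ℝ k L y) (hinj : Function.Injective (L y))
    {W : Euc n → Euc (n + 1)} (hW : ContDiffAt ℝ k W y) :
    ContDiffAt ℝ k (fun z => pinv (L z) (W z)) y := by
  rw [contDiffAt_euclidean]
  intro i
  change ContDiffAt ℝ k
    (fun z => ∑ j, (gramMatrix (L z))⁻¹ i j * inner ℝ (L z (basisVec j)) (W z)) y
  exact ContDiffAt.sum fun j _ => (contDiffAt_inv_apply (contDiffAt_gramMatrix hL)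
    (gramMatrix_det_pos hinj).ne' i j).mul ((hL.clm_apply contDiffAt_const).inner ℝ hW)

/-- The derivative of the area density: `D√g [v] = √g tr (L⁺ ∘ DL[v])`. -/
theorem fderiv_areaDensity (hL : DifferentiableAt ℝ L y) (hinj : Function.Injective (L y))
    (hd : DifferentiableAt ℝ (fun z => areaDensity (L z)) y) (v : Euc n) :
    fderiv ℝ (fun z => areaDensity (L z)) y v = areaDensity (L y) *
      LinearMap.trace ℝ _ (pinv (L y) ∘ₗ (fderiv ℝ L y v : Euc n →ₗ[ℝ] Euc (n + 1))) := by
  have hline : HasDerivAt (fun t : ℝ => y + t • v) v 0 := by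
    simpa using ((hasDerivAt_id (0 : ℝ)).smul_const v).const_add y
  have hy : y + (0 : ℝ) • v = y := by simp
  have h1 : HasDerivAt (fun t : ℝ => areaDensity (L (y + t • v)))
      (fderiv ℝ (fun z => areaDensity (L z)) y v) 0 :=
    hd.hasFDerivAt.comp_hasDerivAt_of_eq (0 : ℝ) hline hy.symm
  have hLl : HasDerivAt (fun t : ℝ => L (y + t • v)) (fderiv ℝ L y v) 0 :=
    hL.hasFDerivAt.comp_hasDerivAt_of_eq (0 : ℝ) hline hy.symm
  set S : Matrix (Fin n) (Fin n) ℝ := Matrix.of fun i j =>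
    inner ℝ (fderiv ℝ L y v (basisVec i)) (L y (basisVec j)) with hS
  have hg : ∀ i j, HasDerivAt (fun t : ℝ => gramMatrix (L (y + t • v)) i j)
      ((S + S.transpose) i j) 0 := by
    intro i j
    have hi := hLl.clm_apply (hasDerivAt_const (0 : ℝ) (basisVec i : Euc n))
    have hj := hLl.clm_apply (hasDerivAt_const (0 : ℝ) (basisVec j : Euc n))
    have := hi.inner ℝ hj
    refine this.congr_deriv ?_
    simp [hS, real_inner_comm, add_comm]
  have hpos := gramMatrix_det_pos hinj
  have h2 := (hasDerivAt_det hg (by simpa using hpos.ne')).sqrt (by simpa using hpos.ne')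
  rw [h1.unique h2, trace_pinv_comp, ← hS]
  simp only [zero_smul, add_zero]
  -- The derivative of the Gram matrix is `S + Sᵀ`. Its two halves have equal trace against the
  -- symmetric `g⁻¹`, and the resulting 2 cancels the 1/2 from the square root.
  have htr : ((gramMatrix (L y))⁻¹ * (S + S.transpose)).trace
      = 2 * ((gramMatrix (L y))⁻¹ * S).trace := by
    rw [Matrix.mul_add, Matrix.trace_add, two_mul]
    congr 1
    rw [← Matrix.trace_transpose, Matrix.transpose_mul, Matrix.transpose_transpose,
      Matrix.transpose_nonsing_inv, Matrix.trace_mul_comm]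
    congr 3
    ext i j
    simp [gramMatrix, real_inner_comm]
  rw [htr, areaDensity]
  have hs0 := (Real.sqrt_pos.2 hpos).ne'
  field_simp
  rw [Real.sq_sqrt hpos.le]
  ring

variable {F ν : Euc n → Euc (n + 1)} {W : Euc n → Euc (n + 1)}

/-- The divergence of the tangential part of a vector field along a hypersurface, in coordinates:
`div (W^T) = div W - H ⟪ν, W⟫`. -/
theorem trace_fderiv_smul_pinv (hF : ContDiffAt ℝ ∞ F y)
    (hinj : Function.Injective (fderiv ℝ F y))
    (hinj' : ∀ᶠ z in 𝓝 y, Function.Injective (fderiv ℝ F z))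
    (hν : DifferentiableAt ℝ ν y) (hν1 : ‖ν y‖ = 1)
    (hνL : ∀ᶠ z in 𝓝 y, ∀ v, inner ℝ (ν z) (fderiv ℝ F z v) = 0) (hW : ContDiffAt ℝ 1 W y) :
    LinearMap.trace ℝ _ (fderiv ℝ (fun z => areaDensity (fderiv ℝ F z) •
        pinv (fderiv ℝ F z) (W z)) y : Euc n →ₗ[ℝ] Euc n) =
      areaDensity (fderiv ℝ F y) *
        (LinearMap.trace ℝ _ (pinv (fderiv ℝ F y) ∘ₗ
            (fderiv ℝ W y : Euc n →ₗ[ℝ] Euc (n + 1))) -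
          inner ℝ (ν y) (W y) * LinearMap.trace ℝ _ (pinv (fderiv ℝ F y) ∘ₗ
            (fderiv ℝ ν y : Euc n →ₗ[ℝ] Euc (n + 1)))) := by
  set L := fun z => fderiv ℝ F z with hLdef
  have hL : ContDiffAt ℝ 1 L y := hF.fderiv_right (m := 1) (by norm_num; exact two_le_infty)
  set X := fun z => pinv (L z) (W z) with hX
  have hXc : ContDiffAt ℝ 1 X y := contDiffAt_pinv hL hinj hW
  have hXd := hXc.differentiableAt one_ne_zero
  have hLd := hL.differentiableAt one_ne_zero
  have hWd := hW.differentiableAt one_ne_zero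
  have hwd := (contDiffAt_areaDensity hL hinj).differentiableAt one_ne_zero
  have hsymm : ∀ v w, fderiv ℝ L y v w = fderiv ℝ L y w v := by
    intro v w
    exact (hF.isSymmSndFDerivAt (by simpa using two_le_infty)).eq v w
  have hνy := hνL.self_of_nhds
  -- derivative of orthogonality
  have horth : ∀ h v, inner ℝ (ν y) (fderiv ℝ L y h v) = -inner ℝ (fderiv ℝ ν y h) (L y v) := by
    intro h v
    have h1 : HasFDerivAt (fun z => inner ℝ (ν z) (L z v)) _ y :=
      hν.hasFDerivAt.inner ℝ (hLd.hasFDerivAt.clm_apply (hasFDerivAt_const v y))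
    have h2 : HasFDerivAt (fun z => (inner ℝ (ν z) (L z v) : ℝ)) (0 : Euc n →L[ℝ] ℝ) y :=
      (hasFDerivAt_const (0 : ℝ) y).congr_of_eventuallyEq (hνL.mono fun z hz => hz v)
    have h3 := congrArg (fun T : Euc n →L[ℝ] ℝ => T h) (h1.unique h2)
    simp [fderivInnerCLM_apply] at h3
    linarith
  -- Differentiate the normal equations `⟪L v, L X⟫ = ⟪L v, W⟫` in the direction `h`. The terms with
  -- `DL[h] v` leave `⟪ν, W⟫ ⟪DL[h] v, ν⟫`, which `horth` turns into a derivative of `ν`. Symmetry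
  -- of the second derivative replaces `DL[h] X` by `DL[X] h`.
  have hDX : ∀ h, fderiv ℝ X y h = pinv (L y) (fderiv ℝ W y h - fderiv ℝ L y (X y) h -
      (inner ℝ (ν y) (W y) : ℝ) • fderiv ℝ ν y h) := by
    intro h
    apply eq_pinv hinj
    intro v
    have hev : ∀ᶠ z in 𝓝 y, inner ℝ (L z v) (L z (X z)) = inner ℝ (L z v) (W z) :=
      hinj'.mono fun z hz => inner_pinv hz _ _
    have hLv := hLd.hasFDerivAt.clm_apply (hasFDerivAt_const v y)
    have h1 : HasFDerivAt (fun z => inner ℝ (L z v) (L z (X z))) _ y :=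
      hLv.inner ℝ (hLd.hasFDerivAt.clm_apply hXd.hasFDerivAt)
    have h2 : HasFDerivAt (fun z => inner ℝ (L z v) (W z)) _ y := hLv.inner ℝ hWd.hasFDerivAt
    have h3 := congrArg (fun T : Euc n →L[ℝ] ℝ => T h)
      (h1.unique (h2.congr_of_eventuallyEq hev))
    simp [fderivInnerCLM_apply, inner_add_right] at h3
    have hP : L y (X y) = W y - (inner ℝ (ν y) (W y) : ℝ) • ν y := apply_pinv hinj hν1 hνy (W y)
    rw [hP] at h3
    have ho := horth h v
    rw [inner_sub_right, inner_smul_right, real_inner_comm (ν y), ho] at h3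
    rw [inner_sub_right, inner_sub_right, inner_smul_right, hsymm (X y) h,
      real_inner_comm (fderiv ℝ ν y h)]
    linarith
  have hprod := hwd.hasFDerivAt.smul hXd.hasFDerivAt
  have hfd := hprod.fderiv
  change LinearMap.trace ℝ _ (fderiv ℝ (fun z => areaDensity (L z) • X z) y : Euc n →ₗ[ℝ] Euc n) = _
  have hfd' : fderiv ℝ (fun z => areaDensity (L z) • X z) y = _ := hfd
  rw [hfd', ContinuousLinearMap.toLinearMap_add, map_add, ContinuousLinearMap.toLinearMap_smul, map_smul]
  have hDXl : (fderiv ℝ X y : Euc n →ₗ[ℝ] Euc n) =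
      pinv (L y) ∘ₗ (fderiv ℝ W y : Euc n →ₗ[ℝ] Euc (n + 1))
      - pinv (L y) ∘ₗ (fderiv ℝ L y (X y) : Euc n →ₗ[ℝ] Euc (n + 1))
      - (inner ℝ (ν y) (W y) : ℝ) • (pinv (L y) ∘ₗ
          (fderiv ℝ ν y : Euc n →ₗ[ℝ] Euc (n + 1))) := by
    ext1 h
    change fderiv ℝ X y h = _
    rw [hDX h]
    simp
  -- The derivative of the density contributes `√g tr (L⁺ DL[X])`, which cancels the
  -- second-derivative term of `DX`. No Christoffel symbols remain.
  have htr2 : LinearMap.trace ℝ _ ((((fderiv ℝ (fun z => areaDensity (L z)) y).smulRight (X y) :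
      Euc n →L[ℝ] Euc n)) : Euc n →ₗ[ℝ] Euc n) = areaDensity (L y) *
      LinearMap.trace ℝ _ (pinv (L y) ∘ₗ (fderiv ℝ L y (X y) : Euc n →ₗ[ℝ] Euc (n + 1))) := by
    rw [← fderiv_areaDensity hLd hinj hwd (X y)]
    exact LinearMap.trace_smulRight _ _
  rw [htr2, hDXl, map_sub, map_sub, map_smul]
  simp only [smul_eq_mul]
  ring

end Divergence

/-! ### Integration by parts against Lipschitz functions on a coordinate patch. -/

section IntegrationByParts

variable {n : ℕ}

theorem trace_fderiv_eq_sum {X : Euc n → Euc n} {y : Euc n} (hX : DifferentiableAt ℝ X y) :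
    LinearMap.trace ℝ _ (fderiv ℝ X y : Euc n →ₗ[ℝ] Euc n) =
      ∑ i, lineDeriv ℝ (fun z => X z i) y (basisVec i) := by
  rw [LinearMap.trace_eq_matrix_trace ℝ (EuclideanSpace.basisFun (Fin n) ℝ).toBasis]
  rw [Matrix.trace]
  refine Finset.sum_congr rfl fun i _ => ?_
  rw [Matrix.diag_apply, LinearMap.toMatrix_apply]
  have h : HasFDerivAt (fun z => X z i) ((EuclideanSpace.proj i).comp (fderiv ℝ X y)) y :=
    (EuclideanSpace.proj (𝕜 := ℝ) i).hasFDerivAt.comp y hX.hasFDerivAt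
  rw [(h.hasLineDerivAt (basisVec i)).lineDeriv]
  simp [basisVec]

/-- The divergence theorem for a compactly supported vector field, tested against a locally
Lipschitz function. -/
theorem abs_integral_mul_trace_fderiv_le {U : Set (Euc n)} (hU : IsOpen U) {X : Euc n → Euc n}
    (hX : ContDiff ℝ 1 X) (hXc : HasCompactSupport X) (hXU : tsupport X ⊆ U) {h : Euc n → ℝ}
    (hh : LocallyLipschitzOn U h) {N : Euc n → ℝ} (hN : Integrable N)
    (hN0 : ∀ y, 0 ≤ N y)
    (hle : ∀ y ∈ U, DifferentiableAt ℝ h y → |fderiv ℝ h y (X y)| ≤ N y) :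
    |∫ y, h y * LinearMap.trace ℝ _ (fderiv ℝ X y : Euc n →ₗ[ℝ] Euc n)| ≤ ∫ y, N y := by
  obtain ⟨K, hK, hXK, hKU⟩ := exists_compact_between hXc hU hXU
  obtain ⟨C, hC⟩ := (hh.mono hKU).exists_lipschitzOnWith_of_compact hK
  -- A globally Lipschitz function that agrees with `h` near the support of `X` replaces `h` in both
  -- integrals.
  obtain ⟨g, hg, hgh⟩ := hC.extend_real
  have hgh' : ∀ y ∈ tsupport X, g =ᶠ[𝓝 y] h := fun y hy =>
    (hgh.symm).eventuallyEq_of_mem (mem_interior_iff_mem_nhds.1 (hXK hy))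
  have hXd : Differentiable ℝ X := hX.differentiable one_ne_zero
  have hXi : ∀ i, ContDiff ℝ 1 (fun z => X z i) := fun i => contDiff_euclidean.1 hX i
  have hXic : ∀ i, HasCompactSupport (fun z => X z i) := fun i =>
    hXc.comp_left (g := fun v : Euc n => v i) rfl
  have hXL : ∀ i, ∃ D, LipschitzWith D (fun z => X z i) := fun i =>
    (hXi i).lipschitzWith_of_hasCompactSupport (hXic i) one_ne_zero
  have hint1 : ∀ i, Integrable fun y => lineDeriv ℝ (fun z => X z i) y (basisVec i) * g y := by
    intro i
    have heq : (fun y => lineDeriv ℝ (fun z => X z i) y (basisVec i)) =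
        fun y => fderiv ℝ (fun z => X z i) y (basisVec i) := by
      ext y
      exact (((hXi i).differentiable one_ne_zero) y).lineDeriv_eq_fderiv
    have hcont : Continuous fun y => fderiv ℝ (fun z => X z i) y (basisVec i) :=
      ((hXi i).continuous_fderiv one_ne_zero).clm_apply continuous_const
    simp_rw [congrFun heq]
    refine (hcont.mul hg.continuous).integrable_of_hasCompactSupport ?_
    exact (((hXic i).fderiv (𝕜 := ℝ)).comp_left
      (g := fun T : Euc n →L[ℝ] ℝ => T (basisVec i)) rfl).mul_right
  have hint2 : ∀ i, Integrable fun y => lineDeriv ℝ g y (basisVec i) * X y i := by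
    intro i
    have := (hg.locallyIntegrable_lineDeriv (μ := volume)
      (basisVec i)).integrable_smul_right_of_hasCompactSupport (hXi i).continuous (hXic i)
    simpa using this
  have e1 : ∀ y, h y * LinearMap.trace ℝ _ (fderiv ℝ X y : Euc n →ₗ[ℝ] Euc n) =
      ∑ i, lineDeriv ℝ (fun z => X z i) y (basisVec i) * g y := by
    intro y
    rw [← Finset.sum_mul, ← trace_fderiv_eq_sum (hXd y), mul_comm]
    by_cases hy : y ∈ tsupport X
    · rw [(hgh' y hy).self_of_nhds]
    · have : fderiv ℝ X y = 0 := by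
        by_contra h0
        exact hy (support_fderiv_subset ℝ h0)
      simp [this]
  have e2 : ∀ i, ∫ y, lineDeriv ℝ (fun z => X z i) y (basisVec i) * g y =
      -∫ y, lineDeriv ℝ g y (basisVec i) * X y i := by
    intro i
    obtain ⟨D, hD⟩ := hXL i
    rw [hg.integral_lineDeriv_mul_eq hD (hXic i) (basisVec i), ← integral_neg]
    simp [lineDeriv_neg]
  simp_rw [e1]
  rw [integral_finsetSum _ fun i _ => hint1 i]
  simp_rw [e2]
  rw [Finset.sum_neg_distrib, abs_neg, ← integral_finsetSum _ fun i _ => hint2 i]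
  refine (abs_integral_le_integral_abs).trans ?_
  refine integral_mono_ae (integrable_finsetSum _ fun i _ => hint2 i).abs hN ?_
  -- Rademacher's theorem: the pointwise bound is needed only where `g` is differentiable.
  filter_upwards [hg.ae_differentiableAt] with y hy
  have : ∑ i, lineDeriv ℝ g y (basisVec i) * X y i = fderiv ℝ g y (X y) := by
    conv_rhs => rw [← sum_basisVec (X y)]
    rw [map_sum]
    refine Finset.sum_congr rfl fun i _ => ?_
    rw [hy.lineDeriv_eq_fderiv, map_smul, smul_eq_mul, mul_comm]
  rw [this]
  by_cases hyX : y ∈ tsupport X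
  · rw [(hgh' y hyX).fderiv_eq]
    exact hle y (hXU hyX) ((hgh' y hyX).differentiableAt_iff.1 hy)
  · rw [image_eq_zero_of_notMem_tsupport hyX]
    simpa using hN0 y

/-- If the variation of `h` along each segment in `U` is controlled by the length of the image of
the segment under `F`, then `h` is locally Lipschitz. -/
theorem locallyLipschitzOn_of_segment {U : Set (Euc n)} (hU : IsOpen U) {F : Euc n → Euc (n + 1)}
    (hF : ContDiffOn ℝ 1 F U) {h : Euc n → ℝ} {ε : ℝ} (hε : 0 ≤ ε)
    (hseg : ∀ y v c, (∀ t ∈ Icc (0 : ℝ) 1, y + t • v ∈ U ∧ ‖fderiv ℝ F (y + t • v) v‖ ≤ c) →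
      |h (y + v) - h y| ≤ ε * c) : LocallyLipschitzOn U h := by
  intro y hy
  have hcont : ContinuousAt (fderiv ℝ F) y :=
    (hF.continuousOn_fderiv_of_isOpen hU le_rfl).continuousAt (hU.mem_nhds hy)
  have hev : ∀ᶠ z in 𝓝 y, z ∈ U ∧ ‖fderiv ℝ F z‖ < ‖fderiv ℝ F y‖ + 1 :=
    (hU.eventually_mem hy).and
      (hcont.norm.eventually_lt_const (lt_add_one _))
  obtain ⟨r, hr, hball⟩ := Metric.eventually_nhds_iff_ball.1 hev
  refine ⟨⟨ε * (‖fderiv ℝ F y‖ + 1), by positivity⟩, Metric.ball y r,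
    mem_nhdsWithin_of_mem_nhds (Metric.ball_mem_nhds y hr), ?_⟩
  refine LipschitzOnWith.of_dist_le_mul fun a ha b hb => ?_
  have := hseg b (a - b) ((‖fderiv ℝ F y‖ + 1) * ‖a - b‖) fun t ht => by
    have hz : b + t • (a - b) ∈ Metric.ball y r :=
      (convex_ball y r).add_smul_sub_mem hb ha ht
    refine ⟨(hball _ hz).1, ?_⟩
    exact (ContinuousLinearMap.le_opNorm _ _).trans
      (mul_le_mul_of_nonneg_right (hball _ hz).2.le (norm_nonneg _))
  rw [add_sub_cancel] at this
  rw [Real.dist_eq, dist_eq_norm]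
  exact this.trans_eq (mul_assoc _ _ _).symm

/-- The difference quotients over `[y, y + t v]` are bounded by the maximal speed of the image under
`F`, which tends to `‖DF v‖` as `t → 0`. This turns a Lipschitz bound for the intrinsic distance
into a gradient bound. -/
theorem abs_fderiv_le_of_segment {U : Set (Euc n)} (hU : IsOpen U) {F : Euc n → Euc (n + 1)}
    (hF : ContDiffOn ℝ 1 F U) {h : Euc n → ℝ} {ε : ℝ} (hε : 0 ≤ ε)
    (hseg : ∀ y v c, (∀ t ∈ Icc (0 : ℝ) 1, y + t • v ∈ U ∧ ‖fderiv ℝ F (y + t • v) v‖ ≤ c) →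
      |h (y + v) - h y| ≤ ε * c) {y : Euc n} (hy : y ∈ U) (hd : DifferentiableAt ℝ h y)
    (v : Euc n) : |fderiv ℝ h y v| ≤ ε * ‖fderiv ℝ F y v‖ := by
  refine le_of_forall_pos_le_add fun δ hδ => ?_
  obtain ⟨δ', hδ', hle⟩ : ∃ δ' > 0, ε * (‖fderiv ℝ F y v‖ + δ') ≤ ε * ‖fderiv ℝ F y v‖ + δ := by
    -- Dividing by `ε + 1` covers the case `ε = 0`.
    refine ⟨δ / (ε + 1), by positivity, ?_⟩
    rw [mul_add]
    have : ε * (δ / (ε + 1)) ≤ δ := by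
      rw [← mul_div_assoc, div_le_iff₀ (by positivity)]
      nlinarith
    linarith
  refine le_trans ?_ hle
  have hcont : ContinuousAt (fun z => fderiv ℝ F z v) y :=
    ((hF.continuousOn_fderiv_of_isOpen hU le_rfl).continuousAt (hU.mem_nhds hy)).clm_apply
      continuousAt_const
  have hev : ∀ᶠ z in 𝓝 y, z ∈ U ∧ ‖fderiv ℝ F z v‖ < ‖fderiv ℝ F y v‖ + δ' :=
    (hU.eventually_mem hy).and (hcont.norm.eventually_lt_const (lt_add_of_pos_right _ hδ'))
  have hline : Tendsto (fun t : ℝ => y + t • v) (𝓝 0) (𝓝 y) := by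
    have : Continuous fun t : ℝ => y + t • v := by fun_prop
    simpa using this.tendsto 0
  obtain ⟨r, hr, hball⟩ := Metric.eventually_nhds_iff_ball.1 (hline.eventually hev)
  have hslope := (hd.hasFDerivAt.hasLineDerivAt v).tendsto_slope_zero_right
  refine le_of_tendsto hslope.abs ?_
  filter_upwards [Ioo_mem_nhdsGT hr] with t ht
  have h1 := hseg y (t • v) (t * (‖fderiv ℝ F y v‖ + δ')) fun s hs => by
    have hst : s * t ∈ Metric.ball (0 : ℝ) r := by
      rw [mem_ball_zero_iff, Real.norm_eq_abs, abs_of_nonneg (mul_nonneg hs.1 ht.1.le)]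
      nlinarith [hs.2, ht.1, ht.2]
    have := hball _ hst
    rw [smul_smul]
    refine ⟨this.1, ?_⟩
    rw [map_smul, norm_smul, Real.norm_eq_abs, abs_of_pos ht.1]
    exact mul_le_mul_of_nonneg_left this.2.le ht.1.le
  rw [smul_eq_mul, abs_mul, abs_inv, abs_of_pos ht.1, inv_mul_le_iff₀ ht.1]
  linarith

/-- Integration by parts on a coordinate patch of a hypersurface, against a function whose gradient
is bounded by `ε`. -/
theorem abs_integral_patch_le {U : Set (Euc n)} (hU : IsOpen U) {F ν : Euc n → Euc (n + 1)}
    (hF : ContDiffOn ℝ ∞ F U) (hinj : ∀ y ∈ U, Function.Injective (fderiv ℝ F y))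
    (hν : ContDiffOn ℝ ∞ ν U) (hν1 : ∀ y ∈ U, ‖ν y‖ = 1)
    (hνF : ∀ y ∈ U, ∀ v, inner ℝ (ν y) (fderiv ℝ F y v) = 0)
    {r : Euc n → ℝ} (hr : ContDiff ℝ 1 r) (hrc : HasCompactSupport r) (hrU : tsupport r ⊆ U)
    (hr0 : ∀ y, 0 ≤ r y) {Φ : Euc (n + 1) → Euc (n + 1)} (hΦ : ContDiff ℝ 1 Φ)
    {h : Euc n → ℝ} {ε : ℝ} (hε : 0 ≤ ε)
    (hseg : ∀ y v c, (∀ t ∈ Icc (0 : ℝ) 1, y + t • v ∈ U ∧ ‖fderiv ℝ F (y + t • v) v‖ ≤ c) →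
      |h (y + v) - h y| ≤ ε * c) :
    |∫ y, h y * (areaDensity (fderiv ℝ F y) *
      (fderiv ℝ r y (pinv (fderiv ℝ F y) (Φ (F y))) +
        r y * (tangentialTrace (fderiv ℝ F y) ((fderiv ℝ Φ (F y)).comp (fderiv ℝ F y)) -
          inner ℝ (ν y) (Φ (F y)) * tangentialTrace (fderiv ℝ F y) (fderiv ℝ ν y))))| ≤
      ε * ∫ y, areaDensity (fderiv ℝ F y) * (r y * ‖Φ (F y)‖) := by
  simp only [tangentialTrace]
  -- The coordinate form of `√g (r Φ)^T`. Its Euclidean divergence is `√g` times the divergence on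
  -- the hypersurface.
  set X : Euc n → Euc n := fun z => areaDensity (fderiv ℝ F z) •
        pinv (fderiv ℝ F z) (r z • Φ (F z)) with hXdef
  have hFat : ∀ y ∈ U, ContDiffAt ℝ ∞ F y := fun y hy => hF.contDiffAt (hU.mem_nhds hy)
  have hF1 : ContDiffOn ℝ 1 F U := hF.of_le (one_le_two.trans two_le_infty)
  have hW : ∀ y ∈ U, ContDiffAt ℝ 1 (fun z => r z • Φ (F z)) y := fun y hy =>
    hr.contDiffAt.smul (hΦ.contDiffAt.comp y (hF1.contDiffAt (hU.mem_nhds hy)))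
  have hLat : ∀ y ∈ U, ContDiffAt ℝ 1 (fderiv ℝ F) y := fun y hy =>
    (hFat y hy).fderiv_right (m := 1) (by norm_num; exact two_le_infty)
  have hXsupp : tsupport X ⊆ tsupport r := by
    refine closure_mono fun y hy => ?_
    rw [Function.mem_support] at hy ⊢
    contrapose! hy
    simp [hXdef, hy]
  have hX : ContDiff ℝ 1 X := by
    rw [contDiff_iff_contDiffAt]
    intro y
    by_cases hy : y ∈ tsupport r
    · have hyU := hrU hy
      exact (contDiffAt_areaDensity (hLat y hyU) (hinj y hyU)).smul
        (contDiffAt_pinv (hLat y hyU) (hinj y hyU) (hW y hyU))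
    · have : X =ᶠ[𝓝 y] fun _ => 0 :=
        notMem_tsupport_iff_eventuallyEq.1 fun hy' => hy (hXsupp hy')
      exact contDiffAt_const.congr_of_eventuallyEq this
  have hXc : HasCompactSupport X := hrc.of_isClosed_subset (isClosed_tsupport _) hXsupp
  have hcontN : Continuous fun y => areaDensity (fderiv ℝ F y) * (r y * ‖Φ (F y)‖) := by
    rw [continuous_iff_continuousAt]
    intro y
    by_cases hy : y ∈ tsupport r
    · have hyU := hrU hy
      exact (contDiffAt_areaDensity (hLat y hyU) (hinj y hyU)).continuousAt.mul
        (hr.continuous.continuousAt.mul (hΦ.continuous.continuousAt.comp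
          (hFat y hyU).continuousAt).norm)
    · have : (fun y => areaDensity (fderiv ℝ F y) * (r y * ‖Φ (F y)‖)) =ᶠ[𝓝 y] fun _ => 0 :=
        (notMem_tsupport_iff_eventuallyEq.1 hy).mono fun z hz => by simp [hz]
      exact continuousAt_const.congr this.symm
  have hintN : Integrable fun y => areaDensity (fderiv ℝ F y) * (r y * ‖Φ (F y)‖) :=
    hcontN.integrable_of_hasCompactSupport (hrc.mul_right.mul_left)
  have key := abs_integral_mul_trace_fderiv_le hU hX hXc (hXsupp.trans hrU)
    (locallyLipschitzOn_of_segment hU hF1 hε hseg) (hintN.const_mul ε)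
    (fun y => mul_nonneg hε (mul_nonneg (Real.sqrt_nonneg _)
      (mul_nonneg (hr0 y) (norm_nonneg _)))) ?_
  · rw [integral_const_mul] at key
    refine le_trans (le_of_eq ?_) key
    congr 2
    ext y
    congr 1
    by_cases hy : y ∈ tsupport r
    · have hyU := hrU hy
      rw [trace_fderiv_smul_pinv (hFat y hyU) (hinj y hyU)
        ((hU.eventually_mem hyU).mono hinj)
        ((hν.contDiffAt (hU.mem_nhds hyU)).differentiableAt (by simp)) (hν1 y hyU)
        ((hU.eventually_mem hyU).mono hνF) (hW y hyU)]
      congr 1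
      have hd : HasFDerivAt (fun z => r z • Φ (F z)) _ y :=
        (hr.differentiable one_ne_zero y).hasFDerivAt.smul
          ((hΦ.differentiable one_ne_zero (F y)).hasFDerivAt.comp y
            ((hFat y hyU).differentiableAt (by simp)).hasFDerivAt)
      rw [hd.fderiv]
      have : pinv (fderiv ℝ F y) ∘ₗ ((r y • (fderiv ℝ Φ (F y)).comp (fderiv ℝ F y) +
          (fderiv ℝ r y).smulRight (Φ (F y)) : Euc n →L[ℝ] Euc (n + 1)) :
            Euc n →ₗ[ℝ] Euc (n + 1)) =
          r y • (pinv (fderiv ℝ F y) ∘ₗ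
            ((fderiv ℝ Φ (F y)).comp (fderiv ℝ F y) : Euc n →ₗ[ℝ] Euc (n + 1))) +
          (fderiv ℝ r y : Euc n →ₗ[ℝ] ℝ).smulRight (pinv (fderiv ℝ F y) (Φ (F y))) := by
        ext1 v
        simp
      erw [this]
      rw [map_add, map_smul, LinearMap.trace_smulRight]
      simp only [smul_eq_mul, inner_smul_right, ContinuousLinearMap.coe_coe]
      ring
    · have h1 : r y = 0 := image_eq_zero_of_notMem_tsupport hy
      have h2 : fderiv ℝ r y = 0 := by
        by_contra h0
        exact hy (support_fderiv_subset ℝ h0)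
      have h3 : fderiv ℝ X y = 0 := by
        by_contra h0
        exact hy (hXsupp (support_fderiv_subset ℝ h0))
      rw [h3]
      simp [h1, h2]
  · intro y hy hd
    refine (abs_fderiv_le_of_segment hU hF1 hε hseg hy hd _).trans ?_
    refine mul_le_mul_of_nonneg_left ?_ hε
    simp only [hXdef, map_smul, norm_smul, Real.norm_eq_abs]
    have hw : 0 ≤ areaDensity (fderiv ℝ F y) := Real.sqrt_nonneg _
    rw [abs_of_nonneg (hr0 y), abs_of_nonneg hw]
    exact mul_le_mul_of_nonneg_left (mul_le_mul_of_nonneg_left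
      (norm_apply_pinv_le (hinj y hy) _) (hr0 y)) (Real.sqrt_nonneg _)

end IntegrationByParts

/-! ### The induced metric and its Riemannian distance. -/

section Riemannian

open Bundle

variable {n : ℕ} {M : Type*} [TopologicalSpace M] [ChartedSpace (Euc n) M]
  [IsManifold (𝓡 n) ∞ M]

/-- The inner product on `T_p M` induced by the immersion `f`. -/
def inducedInner (f : M → Euc (n + 1)) (p : M) : Euc n →L[ℝ] Euc n →L[ℝ] ℝ :=
  (innerSL ℝ).bilinearComp (differential f p) (differential f p)

/-- In a local trivialization of the tangent bundle, the form is the pullback of the Euclidean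
product by the differential in tangent coordinates, which is continuous because `f` is smooth. -/
theorem continuous_inducedInner {f : M → Euc (n + 1)}
    (hf : ContMDiff (𝓡 n) 𝓘(ℝ, Euc (n + 1)) ∞ f) :
    Continuous fun p : M => TotalSpace.mk' (Euc n →L[ℝ] Euc n →L[ℝ] ℝ)
      (E := fun p : M => TangentSpace (𝓡 n) p →L[ℝ] TangentSpace (𝓡 n) p →L[ℝ] ℝ)
      p (inducedInner f p) := by
  rw [continuous_iff_continuousAt]
  intro p
  rw [continuousAt_hom_bundle]
  refine ⟨continuousAt_id, ?_⟩
  have hD := ((hf p).mfderiv_const (m := 0) (by simp)).continuousAt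
  have h2 : ContinuousAt (fun q => (innerSL ℝ).bilinearComp
      (inTangentCoordinates (𝓡 n) 𝓘(ℝ, Euc (n + 1)) id f (mfderiv (𝓡 n) 𝓘(ℝ, Euc (n + 1)) f) p q)
      (inTangentCoordinates (𝓡 n) 𝓘(ℝ, Euc (n + 1)) id f
        (mfderiv (𝓡 n) 𝓘(ℝ, Euc (n + 1)) f) p q)) p := by
    refine continuousAt_clm_apply.2 fun v => continuousAt_clm_apply.2 fun w => ?_
    exact ContinuousAt.inner (hD.clm_apply continuousAt_const) (hD.clm_apply continuousAt_const)
  refine h2.congr ?_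
  have hb : ∀ᶠ q in 𝓝 p, q ∈ (trivializationAt (Euc n) (TangentSpace (𝓡 n) : M → Type _) p).baseSet :=
    (trivializationAt (Euc n) (TangentSpace (𝓡 n) : M → Type _) p).open_baseSet.mem_nhds
      (FiberBundle.mem_baseSet_trivializationAt' p)
  filter_upwards [hb] with q hq
  ext v w
  refine Eq.trans ?_ (inCoordinates_apply_eq₂ (E₃ := fun _ : M => ℝ) hq hq (Set.mem_univ _)).symm
  have hT : ∀ u : Euc n, inTangentCoordinates (𝓡 n) 𝓘(ℝ, Euc (n + 1)) id f
      (mfderiv (𝓡 n) 𝓘(ℝ, Euc (n + 1)) f) p q u = differential f q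
        ((trivializationAt (Euc n) (TangentSpace (𝓡 n) : M → Type _) p).symm q u) := by
    intro u
    have h1 := DFunLike.congr_fun (TangentBundle.continuousLinearMapAt_model_space (𝕜 := ℝ) (f p) (f q))
      (differential f q
        ((trivializationAt (Euc n) (TangentSpace (𝓡 n) : M → Type _) p).symmL ℝ q u))
    refine Eq.trans h1 ?_
    change differential f q _ = _
    congr 1
    exact Trivialization.symmL_apply (R := ℝ)
      (trivializationAt (Euc n) (TangentSpace (𝓡 n) : M → Type _) p) hq u
  have h3 : ∀ (T : Euc n →L[ℝ] Euc (n + 1)), ((innerSL ℝ).bilinearComp T T v w : ℝ) =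
    inner ℝ (T v) (T w) := fun T => rfl
  refine (h3 _).trans ?_
  rw [hT, hT]
  have h4 : ∀ c : ℝ, Trivialization.linearMapAt ℝ (trivializationAt ℝ (fun _ : M => ℝ) p) q c = c :=
    fun c => by simp
  exact (h4 _).symm


/-- The Riemannian metric on `M` induced by the immersion `f`. -/
def inducedMetric {f : M → Euc (n + 1)} (hf : ContMDiff (𝓡 n) 𝓘(ℝ, Euc (n + 1)) ∞ f)
    (hinj : ∀ p, Function.Injective (differential f p)) :
    ContinuousRiemannianMetric (Euc n) (TangentSpace (𝓡 n) : M → Type _) where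
  inner p := inducedInner f p
  symm p v w := real_inner_comm (F := Euc (n + 1)) _ _
  pos p v hv := by
    refine (real_inner_self_pos (F := Euc (n + 1))).2 fun h => hv ?_
    exact hinj p (h.trans (map_zero (differential f p)).symm)
  isVonNBounded p := by
    change Bornology.IsVonNBounded ℝ {v : Euc n | inner ℝ (differential f p v) (differential f p v) < (1 : ℝ)}
    rw [NormedSpace.isVonNBounded_iff, isBounded_iff_forall_norm_le]
    -- An injective linear map in finite dimension is bounded below, so its unit ball is bounded in
    -- the model norm.
    obtain ⟨K, hK, hA⟩ := LinearMap.injective_iff_antilipschitz (differential f p : Euc n →ₗ[ℝ] Euc (n + 1)) |>.1 (hinj p)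
    refine ⟨K, fun v hv => ?_⟩
    have h1 := hA.le_mul_dist v 0
    simp only [dist_zero_right, map_zero, ContinuousLinearMap.coe_coe] at h1
    have hv' : ‖differential f p v‖ ^ 2 < 1 := by
      rw [← real_inner_self_eq_norm_sq]; exact hv
    have h2 : ‖differential f p v‖ ≤ 1 := by nlinarith [norm_nonneg (differential f p v)]
    nlinarith [K.2, NNReal.coe_pos.2 hK]
  continuous := continuous_inducedInner hf

theorem enorm_inducedMetric {f : M → Euc (n + 1)} (hf : ContMDiff (𝓡 n) 𝓘(ℝ, Euc (n + 1)) ∞ f)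
    (hinj : ∀ p, Function.Injective (differential f p)) (p : M) (v : TangentSpace (𝓡 n) p) :
    let : RiemannianBundle (TangentSpace (𝓡 n) : M → Type _) :=
      ⟨(inducedMetric hf hinj).toRiemannianMetric⟩
    ‖v‖ₑ = ‖differential f p v‖ₑ := by
  let : RiemannianBundle (TangentSpace (𝓡 n) : M → Type _) :=
      ⟨(inducedMetric hf hinj).toRiemannianMetric⟩
  have : ‖v‖ = ‖differential f p v‖ := by
    have h1 := norm_eq_sqrt_real_inner (F := TangentSpace (𝓡 n) p) v
    have h2 := norm_eq_sqrt_real_inner (F := Euc (n + 1)) (differential f p v)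
    exact h1.trans h2.symm
  rw [← ofReal_norm (differential f p v), ← this]
  exact (ofReal_norm (E := TangentSpace (𝓡 n) p) v).symm

/-- Both are infima over the same `C¹` paths, and by the chain rule the speed of `γ` in the induced
metric is the Euclidean speed of `f ∘ γ`. -/
theorem intrinsicEDist_eq_riemannianEDist {f : M → Euc (n + 1)}
    (hf : ContMDiff (𝓡 n) 𝓘(ℝ, Euc (n + 1)) ∞ f)
    (hinj : ∀ p, Function.Injective (differential f p)) (p q : M) :
    let : RiemannianBundle (TangentSpace (𝓡 n) : M → Type _) :=
      ⟨(inducedMetric hf hinj).toRiemannianMetric⟩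
    intrinsicEDist f p q = Manifold.riemannianEDist (𝓡 n) p q := by
  let : RiemannianBundle (TangentSpace (𝓡 n) : M → Type _) :=
      ⟨(inducedMetric hf hinj).toRiemannianMetric⟩
  have hlen : ∀ γ : ℝ → M, ContMDiffOn 𝓘(ℝ, ℝ) (𝓡 n) 1 γ (Icc 0 1) →
      Manifold.pathELength (𝓡 n) γ 0 1 =
        ∫⁻ t in Icc (0 : ℝ) 1, ‖derivWithin (f ∘ γ) (Icc 0 1) t‖ₑ := by
    intro γ hγ
    rw [Manifold.pathELength_eq_lintegral_mfderivWithin_Icc]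
    refine setLIntegral_congr_fun measurableSet_Icc fun t ht => ?_
    have hu : UniqueMDiffWithinAt 𝓘(ℝ, ℝ) (Icc (0 : ℝ) 1) t :=
      (uniqueDiffOn_Icc zero_lt_one t ht).uniqueMDiffWithinAt
    have h1 := mfderiv_comp_mfderivWithin t
      ((hf (γ t)).mdifferentiableAt (by simp)) ((hγ t ht).mdifferentiableWithinAt one_ne_zero) hu
    rw [mfderivWithin_eq_fderivWithin] at h1
    refine (enorm_inducedMetric hf hinj (γ t) _).trans ?_
    rw [← fderivWithin_derivWithin]
    congr 1
    exact (DFunLike.congr_fun h1 (1 : ℝ)).symm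
  refine le_antisymm ?_ ?_
  · refine le_of_forall_gt fun r hr => ?_
    obtain ⟨γ, h0, h1, hγ, hlt⟩ := Manifold.exists_lt_of_riemannianEDist_lt hr
    rw [hlen γ hγ] at hlt
    refine lt_of_le_of_lt ?_ hlt
    exact iInf_le_of_le γ (iInf_le_of_le hγ (iInf_le_of_le h0 (iInf_le_of_le h1 le_rfl)))
  · refine le_iInf fun γ => le_iInf fun hγ => le_iInf fun h0 => le_iInf fun h1 => ?_
    rw [← hlen γ hγ]
    exact Manifold.riemannianEDist_le_pathELength hγ h0 h1 zero_le_one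

end Riemannian

/-! ### Hopf–Rinow for extended distances, and cutoff functions. -/

section HopfRinow

open Metric Bundle

variable {X : Type*} [PseudoEMetricSpace X]

/-- Any two points at distance `< r` are joined by a path of which every point `z` satisfies
`edist x z + edist z y < r`. -/
def HasShortPaths (X : Type*) [PseudoEMetricSpace X] : Prop :=
  ∀ (x y : X) (r : ENNReal), edist x y < r → ∃ γ : ℝ → X, ContinuousOn γ (Icc 0 1) ∧ γ 0 = x ∧
    γ 1 = y ∧ ∀ t ∈ Icc (0 : ℝ) 1, edist x (γ t) + edist (γ t) y < r

/-- Take a short path from a point `k` of `K` to `x`. By the intermediate value theorem it passes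
through a point `z` at distance exactly `r` from `K`. As `z` is at distance at least `r` from `k`,
less than `δ` remains between `z` and `x`. -/
theorem HasShortPaths.exists_edist_lt (hX : HasShortPaths X) {K : Set X} {x : X} {r δ : ENNReal}
    (hr : r ≠ ⊤) (hδ : 0 < δ) (hx : infEDist x K < r + δ) : ∃ z, infEDist z K ≤ r ∧ edist z x < δ := by
  by_cases hxr : infEDist x K ≤ r
  · exact ⟨x, hxr, by simpa using hδ⟩
  push Not at hxr
  obtain ⟨k, hk, hkx⟩ := infEDist_lt_iff.1 hx
  rw [edist_comm] at hkx
  obtain ⟨γ, hγ, h0, h1, hlt⟩ := hX k x _ hkx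
  have hcont : ContinuousOn (fun t => infEDist (γ t) K) (Icc 0 1) :=
    continuous_infEDist.comp_continuousOn hγ
  have hmem : r ∈ Icc (infEDist (γ 0) K) (infEDist (γ 1) K) := by
    rw [h0, h1, infEDist_zero_of_mem hk]
    exact ⟨zero_le, hxr.le⟩
  obtain ⟨t, ht, htr⟩ := intermediate_value_Icc zero_le_one hcont hmem
  refine ⟨γ t, htr.le, ?_⟩
  have h2 : r ≤ edist k (γ t) := by
    rw [← htr, edist_comm]
    exact infEDist_le_edist_of_mem hk
  have h3 : r + edist (γ t) x < r + δ := lt_of_le_of_lt (by gcongr) (hlt t ht)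
  exact (ENNReal.add_lt_add_iff_left hr).1 h3

/-- The Hopf–Rinow theorem: in a complete locally compact length space, the closed neighborhoods of
a compact set are compact. -/
theorem HasShortPaths.isCompact_cthickening [CompleteSpace X] [LocallyCompactSpace X]
    (hX : HasShortPaths X) {K : Set X} (hK : IsCompact K) (r : ℝ) : IsCompact (cthickening r K) := by
  have hmono : ∀ {a b : ℝ}, a ≤ b → IsCompact (cthickening b K) → IsCompact (cthickening a K) :=
    fun hab hb => hb.of_isClosed_subset isClosed_cthickening (cthickening_mono hab K)
  -- Compact radii can be enlarged: by local compactness a compact thickening has a compact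
  -- neighbourhood, which contains a slightly larger thickening of `K`.
  have hopen : ∀ a : ℝ, 0 ≤ a → IsCompact (cthickening a K) →
      ∃ δ > 0, IsCompact (cthickening (a + δ) K) := by
    intro a ha hc
    obtain ⟨δ, hδ, hcδ⟩ := hc.exists_isCompact_cthickening
    refine ⟨δ / 2, by positivity, hcδ.of_isClosed_subset isClosed_cthickening fun x hx => ?_⟩
    rw [mem_cthickening_iff, ENNReal.ofReal_add ha (by positivity)] at hx
    have hx' : infEDist x K < ENNReal.ofReal a + ENNReal.ofReal δ := by
      refine hx.trans_lt ((ENNReal.add_lt_add_iff_left ENNReal.ofReal_ne_top).2 ?_)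
      exact (ENNReal.ofReal_lt_ofReal_iff hδ).2 (by linarith)
    obtain ⟨z, hz, hzx⟩ := hX.exists_edist_lt ENNReal.ofReal_ne_top (ENNReal.ofReal_pos.2 hδ) hx'
    rw [mem_cthickening_iff]
    rw [edist_comm] at hzx
    exact (infEDist_le_edist_of_mem (s := cthickening a K) hz).trans hzx.le
  -- Compactness passes to a limit radius: an `e/2`-net of a smaller compact thickening is an
  -- `e`-net of the thickening of radius `c`. With completeness this suffices.
  have hclosed : ∀ c : ℝ, 0 < c → (∀ a, 0 ≤ a → a < c → IsCompact (cthickening a K)) →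
      IsCompact (cthickening c K) := by
    intro c hc hlt
    refine TotallyBounded.isCompact_of_isClosed ?_ isClosed_cthickening
    rw [EMetric.totallyBounded_iff]
    intro ε hε
    obtain ⟨e, he, heε⟩ : ∃ e : ℝ, 0 < e ∧ ENNReal.ofReal e ≤ ε := by
      rcases eq_or_ne ε ⊤ with rfl | h
      · exact ⟨1, one_pos, le_top⟩
      · exact ⟨ε.toReal, ENNReal.toReal_pos hε.ne' h, ENNReal.ofReal_toReal_le⟩
    set a := max 0 (c - e / 4) with ha
    have hac : a < c := max_lt hc (by linarith)
    have hce : c ≤ a + e / 4 := by linarith [le_max_right 0 (c - e / 4)]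
    have htb := EMetric.totallyBounded_iff.1 (hlt a (le_max_left _ _) hac).totallyBounded
      (ENNReal.ofReal (e / 2)) (ENNReal.ofReal_pos.2 (by positivity))
    obtain ⟨t, htf, ht⟩ := htb
    refine ⟨t, htf, fun x hx => ?_⟩
    rw [mem_cthickening_iff] at hx
    have hx' : infEDist x K < ENNReal.ofReal a + ENNReal.ofReal (e / 2) := by
      rw [← ENNReal.ofReal_add (le_max_left _ _) (by positivity)]
      refine hx.trans_lt ((ENNReal.ofReal_lt_ofReal_iff ?_).2 (by linarith))
      linarith [le_max_left 0 (c - e / 4)]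
    obtain ⟨z, hz, hzx⟩ := hX.exists_edist_lt ENNReal.ofReal_ne_top
      (ENNReal.ofReal_pos.2 (by positivity : 0 < e / 2)) hx'
    have hz' := ht (show z ∈ cthickening a K from hz)
    simp only [mem_iUnion, Metric.mem_eball] at hz' ⊢
    obtain ⟨w, hw, hzw⟩ := hz'
    refine ⟨w, hw, ?_⟩
    calc edist x w ≤ edist x z + edist z w := edist_triangle _ _ _
      _ < ENNReal.ofReal (e / 2) + ENNReal.ofReal (e / 2) := by
        rw [edist_comm] at hzx
        exact ENNReal.add_lt_add hzx hzw
      _ = ENNReal.ofReal e := by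
        rw [← ENNReal.ofReal_add (by positivity) (by positivity)]; congr 1; ring
      _ ≤ ε := heε
  by_contra hr
  have h0 : IsCompact (cthickening 0 K) := by
    rw [cthickening_zero]
    exact hK.closure
  set S : Set ℝ := {a | 0 ≤ a ∧ ¬ IsCompact (cthickening a K)} with hS
  have hrS : r ∈ S := by
    refine ⟨?_, hr⟩
    by_contra hneg
    exact hr (hmono (not_le.1 hneg).le h0)
  have hSb : BddBelow S := ⟨0, fun a ha => ha.1⟩
  -- The infimum of the bad radii is itself a good radius by `hclosed`, and then `hopen` contradicts
  -- its being the infimum.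
  set c := sInf S with hc
  have hc0 : 0 ≤ c := le_csInf ⟨r, hrS⟩ fun a ha => ha.1
  have hlt : ∀ a, 0 ≤ a → a < c → IsCompact (cthickening a K) := fun a ha hac => by
    by_contra hn
    exact (csInf_le hSb ⟨ha, hn⟩).not_gt hac
  have hcc : IsCompact (cthickening c K) := by
    rcases hc0.eq_or_lt with h | h
    · rwa [← h]
    · exact hclosed c h hlt
  obtain ⟨δ, hδ, hcδ⟩ := hopen c hc0 hcc
  obtain ⟨a, ha, hac⟩ := exists_lt_of_csInf_lt ⟨r, hrS⟩ (show sInf S < c + δ by linarith)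
  exact ha.2 (hmono hac.le hcδ)

/-- Cutoff functions with small slope. -/
theorem exists_cutoff_of_isCompact_cthickening {K : Set X}
    (hK : ∀ r : ℝ, IsCompact (cthickening r K)) {ε : ℝ} (hε : 0 < ε) :
    ∃ η : X → ℝ, HasCompactSupport η ∧ Continuous η ∧ (∀ x, 0 ≤ η x) ∧ (∀ x, η x ≤ 1) ∧
      (∀ x ∈ K, η x = 1) ∧ ∀ x y, ENNReal.ofReal |η x - η y| ≤ ENNReal.ofReal ε * edist x y := by
  -- Subtraction in `ENNReal` is truncated, so this is `max (0, 1 - ε d(x, K))`, with value 0 at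
  -- infinite distance. It is supported in the thickening of radius `1/ε`.
  set g : X → ENNReal := fun x => 1 - ENNReal.ofReal ε * infEDist x K with hg
  have hg1 : ∀ x, g x ≤ 1 := fun x => tsub_le_self
  have hgt : ∀ x, g x ≠ ⊤ := fun x => ne_top_of_le_ne_top ENNReal.one_ne_top (hg1 x)
  have hgc : Continuous g :=
    (ENNReal.continuous_sub_left ENNReal.one_ne_top).comp
      ((ENNReal.continuous_const_mul ENNReal.ofReal_ne_top).comp continuous_infEDist)
  have hle : ∀ x y, g x ≤ g y + ENNReal.ofReal ε * edist x y := by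
    intro x y
    rw [hg, tsub_le_iff_right]
    calc (1 : ENNReal) ≤ (1 - ENNReal.ofReal ε * infEDist y K) + ENNReal.ofReal ε * infEDist y K :=
          le_tsub_add
      _ ≤ (1 - ENNReal.ofReal ε * infEDist y K) +
          ENNReal.ofReal ε * (infEDist x K + edist y x) := by
          gcongr
          exact infEDist_le_infEDist_add_edist
      _ = _ := by rw [mul_add, edist_comm]; ring
  refine ⟨fun x => (g x).toReal, ?_, ?_, fun x => ENNReal.toReal_nonneg, fun x => ?_, fun x hx => ?_,
    fun x y => ?_⟩
  · refine (hK (1 / ε)).of_isClosed_subset (isClosed_tsupport _) ?_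
    refine closure_minimal (fun x hx => ?_) isClosed_cthickening
    rw [mem_cthickening_iff]
    by_contra hlt
    push Not at hlt
    apply hx
    have : g x = 0 := by
      rw [hg, tsub_eq_zero_iff_le]
      calc (1 : ENNReal) = ENNReal.ofReal ε * ENNReal.ofReal (1 / ε) := by
            rw [← ENNReal.ofReal_mul hε.le, mul_one_div_cancel hε.ne', ENNReal.ofReal_one]
        _ ≤ _ := by gcongr
    simp [this]
  · exact ENNReal.continuousOn_toReal.comp_continuous hgc fun x => hgt x
  · simpa using ENNReal.toReal_mono ENNReal.one_ne_top (hg1 x)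
  · simp [hg, infEDist_zero_of_mem hx]
  · have key : ∀ x y, ENNReal.ofReal ((g x).toReal - (g y).toReal) ≤
        ENNReal.ofReal ε * edist x y := by
      intro x y
      rw [ENNReal.ofReal_sub _ ENNReal.toReal_nonneg, ENNReal.ofReal_toReal (hgt x),
        ENNReal.ofReal_toReal (hgt y), tsub_le_iff_left]
      exact hle x y
    rcases abs_cases ((g x).toReal - (g y).toReal) with h | h
    · rw [h.1]; exact key x y
    · rw [h.1, neg_sub, edist_comm]; exact key y x

variable {n : ℕ} {M : Type*} [TopologicalSpace M] [T2Space M] [ChartedSpace (Euc n) M]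
  [IsManifold (𝓡 n) ∞ M]

/-- On a complete immersed hypersurface there are compactly supported cutoff functions with
arbitrarily small slope for the intrinsic distance. -/
theorem exists_cutoff {f : M → Euc (n + 1)} (hf : ContMDiff (𝓡 n) 𝓘(ℝ, Euc (n + 1)) ∞ f)
    (hinj : ∀ p, Function.Injective (differential f p)) (hc : IsCompleteImmersion f)
    {K : Set M} (hK : IsCompact K) {ε : ℝ} (hε : 0 < ε) :
    ∃ η : M → ℝ, HasCompactSupport η ∧ Continuous η ∧ (∀ x, 0 ≤ η x) ∧ (∀ x, η x ≤ 1) ∧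
      (∀ x ∈ K, η x = 1) ∧
      ∀ x y, ENNReal.ofReal |η x - η y| ≤ ENNReal.ofReal ε * intrinsicEDist f x y := by
  have : LocallyCompactSpace M := ChartedSpace.locallyCompactSpace (Euc n) M
  let : RiemannianBundle (TangentSpace (𝓡 n) : M → Type _) :=
    ⟨(inducedMetric hf hinj).toRiemannianMetric⟩
  let : PseudoEMetricSpace M := .ofRiemannianMetric (𝓡 n) M
  have hd : ∀ x y : M, edist x y = intrinsicEDist f x y := fun x y =>
    (intrinsicEDist_eq_riemannianEDist hf hinj x y).symm
  have hcomplete : CompleteSpace M := by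
    refine EMetric.complete_of_cauchySeq_tendsto fun u hu => hc u fun δ hδ => ?_
    obtain ⟨N, hN⟩ := EMetric.cauchySeq_iff.1 hu δ hδ
    exact ⟨N, fun i hi j hj => by rw [← hd]; exact hN i hi j hj⟩
  -- A nearly minimizing path serves: its length is the sum of the lengths of the pieces before and
  -- after `t`.
  have hshort : HasShortPaths M := by
    intro x y r hr
    obtain ⟨γ, h0, h1, hγ, hlt⟩ := Manifold.exists_lt_of_riemannianEDist_lt hr
    refine ⟨γ, hγ.continuousOn, h0, h1, fun t ht => lt_of_le_of_lt ?_ hlt⟩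
    rw [← Manifold.pathELength_add ht.1 ht.2]
    exact add_le_add
      (Manifold.riemannianEDist_le_pathELength (hγ.mono (Icc_subset_Icc_right ht.2)) h0 rfl ht.1)
      (Manifold.riemannianEDist_le_pathELength (hγ.mono (Icc_subset_Icc_left ht.1)) rfl h1 ht.2)
  simp_rw [← hd]
  exact exists_cutoff_of_isCompact_cthickening (hshort.isCompact_cthickening hK) hε

end HopfRinow

/-! ### Expressions on the hypersurface read in charts. -/

section Charts

variable {n : ℕ} {M : Type*} [TopologicalSpace M] [ChartedSpace (Euc n) M]
  [IsManifold (𝓡 n) ∞ M] {φ : OpenPartialHomeomorph M (Euc n)}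

theorem contMDiffOn_chart_symm (hφ : φ ∈ atlas (Euc n) M) :
    ContMDiffOn 𝓘(ℝ, Euc n) (𝓡 n) ∞ φ.symm φ.target :=
  contMDiffOn_symm_of_mem_maximalAtlas (IsManifold.subset_maximalAtlas hφ)

theorem contMDiffOn_chart (hφ : φ ∈ atlas (Euc n) M) :
    ContMDiffOn (𝓡 n) 𝓘(ℝ, Euc n) ∞ φ φ.source :=
  contMDiffOn_of_mem_maximalAtlas (IsManifold.subset_maximalAtlas hφ)

theorem contDiffOn_comp_chart_symm {E : Type*} [NormedAddCommGroup E] [NormedSpace ℝ E]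
    (hφ : φ ∈ atlas (Euc n) M) {k : ℕ∞ω} (hk : k ≤ ∞) {g : M → E} (hg : ContMDiff (𝓡 n) 𝓘(ℝ, E) k g) :
    ContDiffOn ℝ k (g ∘ φ.symm) φ.target :=
  (hg.comp_contMDiffOn ((contMDiffOn_chart_symm hφ).of_le hk)).contDiffOn

/-- The differential of the inverse of a chart. -/
def chartSymmDeriv (φ : OpenPartialHomeomorph M (Euc n)) (y : Euc n) : Euc n →L[ℝ] Euc n :=
  mfderiv 𝓘(ℝ, Euc n) (𝓡 n) φ.symm y

/-- The differential at `p` of a map from `M` to a vector space, with `T_p M` identified with `ℝⁿ`. -/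
def mderiv {E : Type*} [NormedAddCommGroup E] [NormedSpace ℝ E] (g : M → E) (p : M) :
    Euc n →L[ℝ] E :=
  mfderiv (𝓡 n) 𝓘(ℝ, E) g p

theorem mdifferentiableAt_chart_symm (hφ : φ ∈ atlas (Euc n) M) {y : Euc n} (hy : y ∈ φ.target) :
    MDifferentiableAt 𝓘(ℝ, Euc n) (𝓡 n) φ.symm y :=
  ((contMDiffOn_chart_symm hφ).contMDiffAt (φ.open_target.mem_nhds hy)).mdifferentiableAt (by simp)

theorem fderiv_comp_chart_symm {E : Type*} [NormedAddCommGroup E] [NormedSpace ℝ E]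
    (hφ : φ ∈ atlas (Euc n) M) {g : M → E} {y : Euc n} (hy : y ∈ φ.target)
    (hg : MDifferentiableAt (𝓡 n) 𝓘(ℝ, E) g (φ.symm y)) :
    fderiv ℝ (g ∘ φ.symm) y =
      (mderiv g (φ.symm y)).comp (chartSymmDeriv φ y) := by
  have := mfderiv_comp y hg (mdifferentiableAt_chart_symm hφ hy)
  rw [mfderiv_eq_fderiv] at this
  exact this

theorem bijective_chartSymmDeriv (hφ : φ ∈ atlas (Euc n) M) {y : Euc n} (hy : y ∈ φ.target) :
    Function.Bijective (chartSymmDeriv φ y) := by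
  have hφd : MDifferentiableAt (𝓡 n) 𝓘(ℝ, Euc n) φ (φ.symm y) :=
    ((contMDiffOn_chart hφ).contMDiffAt
      (φ.open_source.mem_nhds (φ.map_target hy))).mdifferentiableAt (by simp)
  have h1 := fderiv_comp_chart_symm hφ hy hφd
  have h2 : fderiv ℝ (φ ∘ φ.symm) y = ContinuousLinearMap.id ℝ (Euc n) := by
    have : (φ ∘ φ.symm) =ᶠ[𝓝 y] id :=
      eventuallyEq_of_mem (φ.open_target.mem_nhds hy) fun z hz => φ.right_inv hz
    rw [this.fderiv_eq, fderiv_id]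
  rw [h2] at h1
  have hinj : Function.Injective (chartSymmDeriv φ y : Euc n →ₗ[ℝ] Euc n) := by
    refine Function.LeftInverse.injective
      (g := mderiv φ (φ.symm y)) fun v => ?_
    exact (DFunLike.congr_fun h1 v).symm
  exact ⟨hinj, LinearMap.injective_iff_surjective.1 hinj⟩

omit [IsManifold (𝓡 n) ∞ M] in
theorem continuous_of_continuousOn_charts {E : Type*} [TopologicalSpace E] {G : M → E}
    (h : ∀ φ ∈ atlas (Euc n) M, ContinuousOn (G ∘ φ.symm) φ.target) : Continuous G := by
  rw [continuous_iff_continuousAt]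
  intro p
  have hp := mem_chart_source (Euc n) p
  have h1 := (h _ (chart_mem_atlas (Euc n) p)).comp (chartAt (Euc n) p).continuousOn
    (chartAt (Euc n) p).mapsTo
  have h2 := h1.continuousAt ((chartAt (Euc n) p).open_source.mem_nhds hp)
  refine h2.congr (eventuallyEq_of_mem ((chartAt (Euc n) p).open_source.mem_nhds hp) fun q hq => ?_)
  simp [(chartAt (Euc n) p).left_inv hq]

variable {f ν : M → Euc (n + 1)}

theorem fderiv_immersion_chart (hf : ContMDiff (𝓡 n) 𝓘(ℝ, Euc (n + 1)) ∞ f)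
    (hφ : φ ∈ atlas (Euc n) M) {y : Euc n} (hy : y ∈ φ.target) :
    fderiv ℝ (f ∘ φ.symm) y = (differential f (φ.symm y)).comp (chartSymmDeriv φ y) :=
  fderiv_comp_chart_symm hφ hy ((hf _).mdifferentiableAt (by simp))

theorem injective_fderiv_chart (hf : ContMDiff (𝓡 n) 𝓘(ℝ, Euc (n + 1)) ∞ f)
    (hinj : ∀ p, Function.Injective (differential f p))
    (hφ : φ ∈ atlas (Euc n) M) {y : Euc n} (hy : y ∈ φ.target) :
    Function.Injective (fderiv ℝ (f ∘ φ.symm) y) := by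
  rw [fderiv_immersion_chart hf hφ hy]
  exact (hinj _).comp (bijective_chartSymmDeriv hφ hy).1

/-- The tangential part of the ambient vector field `Φ`, as a tangent vector of `M`. -/
def tangentialPart (f : M → Euc (n + 1)) (Φ : Euc (n + 1) → Euc (n + 1)) (p : M) : Euc n :=
  pinv (differential f p) (Φ (f p))

/-- The derivative of `ρ` in the direction of the tangential part of `Φ`. -/
def tangentialDeriv (f : M → Euc (n + 1)) (Φ : Euc (n + 1) → Euc (n + 1)) (ρ : M → ℝ) (p : M) : ℝ :=
  mderiv ρ p (tangentialPart f Φ p)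

/-- The divergence on `M` of the tangential part of the ambient vector field `Φ`. -/
def tangentialDiv (f ν : M → Euc (n + 1)) (Φ : Euc (n + 1) → Euc (n + 1)) (p : M) : ℝ :=
  tangentialTrace (differential f p) ((fderiv ℝ Φ (f p)).comp (differential f p)) -
    inner ℝ (ν p) (Φ (f p)) * meanCurvature f ν p

omit [IsManifold (𝓡 n) ∞ M] in
theorem meanCurvature_eq_tangentialTrace (f ν : M → Euc (n + 1)) (p : M) :
    meanCurvature f ν p = tangentialTrace (differential f p) (differential ν p) :=
  (trace_pinv_comp _ _).symm

theorem tangentialDeriv_chart (hf : ContMDiff (𝓡 n) 𝓘(ℝ, Euc (n + 1)) ∞ f)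
    (hinj : ∀ p, Function.Injective (differential f p)) (hφ : φ ∈ atlas (Euc n) M)
    {ρ : M → ℝ} (hρ : ContMDiff (𝓡 n) 𝓘(ℝ, ℝ) 1 ρ) (Φ : Euc (n + 1) → Euc (n + 1))
    {y : Euc n} (hy : y ∈ φ.target) :
    fderiv ℝ (ρ ∘ φ.symm) y (pinv (fderiv ℝ (f ∘ φ.symm) y) (Φ ((f ∘ φ.symm) y))) =
      tangentialDeriv f Φ ρ (φ.symm y) := by
  rw [fderiv_comp_chart_symm hφ hy ((hρ _).mdifferentiableAt one_ne_zero),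
    fderiv_immersion_chart hf hφ hy, ContinuousLinearMap.comp_apply,
    pinv_comp (hinj _) _ (bijective_chartSymmDeriv hφ hy)]
  rfl

theorem tangentialDiv_chart (hf : ContMDiff (𝓡 n) 𝓘(ℝ, Euc (n + 1)) ∞ f)
    (hinj : ∀ p, Function.Injective (differential f p)) (hν : ContMDiff (𝓡 n) 𝓘(ℝ, Euc (n + 1)) ∞ ν)
    (hφ : φ ∈ atlas (Euc n) M) (Φ : Euc (n + 1) → Euc (n + 1)) {y : Euc n} (hy : y ∈ φ.target) :
    tangentialTrace (fderiv ℝ (f ∘ φ.symm) y)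
        ((fderiv ℝ Φ ((f ∘ φ.symm) y)).comp (fderiv ℝ (f ∘ φ.symm) y)) -
      inner ℝ ((ν ∘ φ.symm) y) (Φ ((f ∘ φ.symm) y)) *
        tangentialTrace (fderiv ℝ (f ∘ φ.symm) y) (fderiv ℝ (ν ∘ φ.symm) y) =
      tangentialDiv f ν Φ (φ.symm y) := by
  rw [fderiv_immersion_chart hf hφ hy, fderiv_immersion_chart hν hφ hy,
    ← ContinuousLinearMap.comp_assoc]
  have hA := bijective_chartSymmDeriv hφ hy
  rw [tangentialTrace_comp (hinj _) _ hA, tangentialTrace_comp (hinj _) _ hA, tangentialDiv,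
    meanCurvature_eq_tangentialTrace]
  rfl

theorem continuous_tangentialDeriv (hf : ContMDiff (𝓡 n) 𝓘(ℝ, Euc (n + 1)) ∞ f)
    (hinj : ∀ p, Function.Injective (differential f p))
    {ρ : M → ℝ} (hρ : ContMDiff (𝓡 n) 𝓘(ℝ, ℝ) 1 ρ) {Φ : Euc (n + 1) → Euc (n + 1)}
    (hΦ : ContDiff ℝ 1 Φ) : Continuous (tangentialDeriv f Φ ρ) := by
  refine continuous_of_continuousOn_charts (n := n) fun φ hφ => ?_
  refine ContinuousOn.congr (f := fun y => fderiv ℝ (ρ ∘ φ.symm) y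
    (pinv (fderiv ℝ (f ∘ φ.symm) y) (Φ ((f ∘ φ.symm) y)))) ?_
    fun y hy => (tangentialDeriv_chart hf hinj hφ hρ Φ hy).symm
  intro y hy
  have hF := (contDiffOn_comp_chart_symm hφ le_rfl hf).contDiffAt (φ.open_target.mem_nhds hy)
  refine ContinuousAt.continuousWithinAt ?_
  refine ContinuousAt.clm_apply ?_ ?_
  · exact ((contDiffOn_comp_chart_symm hφ (one_le_two.trans two_le_infty) hρ).continuousOn_fderiv_of_isOpen
      φ.open_target le_rfl).continuousAt (φ.open_target.mem_nhds hy)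
  · refine (contDiffAt_pinv (k := 0) (hF.fderiv_right (m := 0) (by simp)) (injective_fderiv_chart hf hinj hφ hy)
      (W := fun z => Φ ((f ∘ φ.symm) z)) ?_).continuousAt
    exact (hΦ.contDiffAt.of_le zero_le_one).comp y (hF.of_le (by simp))

end Charts

/-! ### The Riemannian volume in charts and under homotheties. -/

section Volume

variable {n : ℕ}

theorem gramMatrix_comp (L : Euc n →L[ℝ] Euc (n + 1)) (A : Euc n →L[ℝ] Euc n) :
    (gramMatrix (L.comp A)).det = A.det ^ 2 * (gramMatrix L).det := by
  set b := (EuclideanSpace.basisFun (Fin n) ℝ).toBasis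
  set m := LinearMap.toMatrix b b (A : Euc n →ₗ[ℝ] Euc n) with hm
  have h1 : gramMatrix (L.comp A) = m.transpose * gramMatrix L * m := by
    have hA : ∀ i, A (basisVec i) = ∑ k, m k i • (basisVec k : Euc n) := by
      intro i
      conv_lhs => rw [← sum_basisVec (A (basisVec i))]
      refine Finset.sum_congr rfl fun k _ => ?_
      rw [hm, LinearMap.toMatrix_apply]
      simp [b, basisVec]
    ext i j
    simp only [gramMatrix, Matrix.of_apply, Matrix.mul_apply, Matrix.transpose_apply,
      ContinuousLinearMap.comp_apply, hA, map_sum, map_smul, sum_inner, inner_sum,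
      inner_smul_left, inner_smul_right, Finset.sum_mul, Finset.mul_sum]
    refine Finset.sum_congr rfl fun k _ => Finset.sum_congr rfl fun l _ => ?_
    rw [real_inner_comm]
    simp
    ring
  have h2 : m.det = A.det := LinearMap.det_toMatrix b _
  rw [h1, Matrix.det_mul, Matrix.det_mul, Matrix.det_transpose, h2]
  ring

theorem areaDensity_comp (L : Euc n →L[ℝ] Euc (n + 1)) (A : Euc n →L[ℝ] Euc n) :
    areaDensity (L.comp A) = |A.det| * areaDensity L := by
  rw [areaDensity, gramMatrix_comp, Real.sqrt_mul (sq_nonneg _), Real.sqrt_sq_eq_abs, areaDensity]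

theorem areaDensity_smul (L : Euc n →L[ℝ] Euc (n + 1)) {c : ℝ} (hc : 0 ≤ c) :
    areaDensity (c • L) = c ^ n * areaDensity L := by
  have : c • L = L.comp (c • ContinuousLinearMap.id ℝ (Euc n)) := by ext v; simp
  rw [this, areaDensity_comp]
  congr 1
  have h : (c • ContinuousLinearMap.id ℝ (Euc n)).det = c ^ n := by
    have : (c • ContinuousLinearMap.id ℝ (Euc n)).det = LinearMap.det (c • LinearMap.id (M := Euc n)) := rfl
    rw [this, LinearMap.det_smul]
    simp
  rw [h, abs_of_nonneg (pow_nonneg hc n)]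

variable {M : Type*} [TopologicalSpace M] [ChartedSpace (Euc n) M]
  [MeasurableSpace M] [BorelSpace M] {φ : OpenPartialHomeomorph M (Euc n)}

omit [ChartedSpace (Euc n) M] in
theorem aemeasurable_chart_symm (φ : OpenPartialHomeomorph M (Euc n)) :
    AEMeasurable φ.symm ((volume : Measure (Euc n)).restrict φ.target) :=
  φ.continuousOn_symm.aemeasurable φ.open_target.measurableSet

omit [ChartedSpace (Euc n) M] in
theorem measurableSet_target_inter_preimage (φ : OpenPartialHomeomorph M (Euc n)) {s : Set M}
    (hs : MeasurableSet s) : MeasurableSet (φ.target ∩ φ.symm ⁻¹' s) := by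
  have h := (continuousOn_iff_continuous_domRestrict.1 φ.continuousOn_symm).measurable hs
  have := φ.open_target.measurableSet.subtype_image h
  convert this using 1
  ext y
  constructor
  · rintro ⟨h1, h2⟩
    exact ⟨⟨y, h1⟩, h2, rfl⟩
  · rintro ⟨⟨z, hz⟩, h2, rfl⟩
    exact ⟨hz, h2⟩

omit [ChartedSpace (Euc n) M] in
theorem chartVolume_apply (f : M → Euc (n + 1)) (φ : OpenPartialHomeomorph M (Euc n)) {s : Set M}
    (hs : MeasurableSet s) : chartVolume f φ s =
      ∫⁻ y in φ.target ∩ φ.symm ⁻¹' s, ENNReal.ofReal (areaDensity (fderiv ℝ (f ∘ φ.symm) y)) := by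
  rw [chartVolume, Measure.map_apply_of_aemeasurable
    ((aemeasurable_chart_symm φ).mono_ac (withDensity_absolutelyContinuous _ _)) hs,
    withDensity_apply', Measure.restrict_restrict' φ.open_target.measurableSet, inter_comm]
  rfl

omit [ChartedSpace (Euc n) M] in
theorem chartVolume_apply_compl_source (f : M → Euc (n + 1))
    (φ : OpenPartialHomeomorph M (Euc n)) : chartVolume f φ φ.sourceᶜ = 0 := by
  rw [chartVolume_apply f φ φ.open_source.measurableSet.compl]
  have : φ.target ∩ φ.symm ⁻¹' φ.sourceᶜ = ∅ := by
    ext y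
    simp only [mem_inter_iff, mem_preimage, mem_compl_iff, mem_empty_iff_false, iff_false, not_and,
      not_not]
    exact fun h => φ.map_target h
  rw [this, setLIntegral_empty]

variable [IsManifold (𝓡 n) ∞ M] {f : M → Euc (n + 1)}

/-- Change of variables under the transition map `T`: the area density picks up `|det DT|`, which is
the Jacobian of the integral. -/
theorem chartVolume_inter_le (hf : ContMDiff (𝓡 n) 𝓘(ℝ, Euc (n + 1)) ∞ f)
    {φ ψ : OpenPartialHomeomorph M (Euc n)} (hφ : φ ∈ atlas (Euc n) M) (hψ : ψ ∈ atlas (Euc n) M)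
    {s : Set M} (hs : MeasurableSet s) (hsφ : s ⊆ φ.source) (hsψ : s ⊆ ψ.source) :
    chartVolume f φ s = chartVolume f ψ s := by
  rw [chartVolume_apply f φ hs, chartVolume_apply f ψ hs]
  set T : Euc n → Euc n := ψ ∘ φ.symm with hT
  have himg : ψ.target ∩ ψ.symm ⁻¹' s = T '' (φ.target ∩ φ.symm ⁻¹' s) := by
    ext z
    constructor
    · rintro ⟨hz, hzs⟩
      refine ⟨φ (ψ.symm z), ⟨φ.map_source (hsφ hzs), ?_⟩, ?_⟩
      · simpa [φ.left_inv (hsφ hzs)] using hzs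
      · simp [hT, φ.left_inv (hsφ hzs), ψ.right_inv hz]
    · rintro ⟨y, ⟨hy, hys⟩, rfl⟩
      refine ⟨ψ.map_source (hsψ hys), ?_⟩
      simpa [hT, ψ.left_inv (hsψ hys)] using hys
  have hopen : IsOpen (φ.target ∩ φ.symm ⁻¹' ψ.source) := φ.isOpen_inter_preimage_symm ψ.open_source
  have hTd : ∀ y ∈ φ.target ∩ φ.symm ⁻¹' s, HasFDerivAt T (fderiv ℝ T y) y := by
    rintro y ⟨hy, hys⟩
    have h1 : ContMDiffAt (𝓡 n) 𝓘(ℝ, Euc n) ∞ ψ (φ.symm y) :=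
      (contMDiffOn_chart hψ).contMDiffAt (ψ.open_source.mem_nhds (hsψ hys))
    have h2 : ContMDiffAt 𝓘(ℝ, Euc n) 𝓘(ℝ, Euc n) ∞ T y :=
      h1.comp y ((contMDiffOn_chart_symm hφ).contMDiffAt (φ.open_target.mem_nhds hy))
    exact (h2.contDiffAt.differentiableAt (by simp)).hasFDerivAt
  have hTinj : InjOn T (φ.target ∩ φ.symm ⁻¹' s) := by
    rintro y ⟨hy, hys⟩ z ⟨hz, hzs⟩ hyz
    have := ψ.injOn (hsψ hys) (hsψ hzs) hyz
    exact φ.symm.injOn hy hz this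
  rw [himg, lintegral_image_eq_lintegral_abs_det_fderiv_mul volume
    (measurableSet_target_inter_preimage φ hs) (fun y hy => (hTd y hy).hasFDerivWithinAt) hTinj]
  refine setLIntegral_congr_fun (measurableSet_target_inter_preimage φ hs) fun y hy => ?_
  have hTy : T y ∈ ψ.target := ψ.map_source (hsψ hy.2)
  have hF : f ∘ φ.symm =ᶠ[𝓝 y] (f ∘ ψ.symm) ∘ T := by
    refine eventuallyEq_of_mem (hopen.mem_nhds ⟨hy.1, hsψ hy.2⟩) fun z hz => ?_
    simp [hT, ψ.left_inv hz.2]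
  have hFψ : DifferentiableAt ℝ (f ∘ ψ.symm) (T y) :=
    ((contDiffOn_comp_chart_symm hψ le_rfl hf).contDiffAt
      (ψ.open_target.mem_nhds hTy)).differentiableAt (by simp)
  rw [hF.fderiv_eq, (hFψ.hasFDerivAt.comp y (hTd y hy)).fderiv, areaDensity_comp,
    ENNReal.ofReal_mul (abs_nonneg _)]

/-- A supremum of measures is not computed set by set. The measure equal to `chartVolume f φ` on the
source and to the volume off it dominates every chart volume, hence also their supremum. -/
theorem riemannianVolume_restrict_source (hf : ContMDiff (𝓡 n) 𝓘(ℝ, Euc (n + 1)) ∞ f)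
    (hφ : φ ∈ atlas (Euc n) M) :
    (riemannianVolume f).restrict φ.source = chartVolume f φ := by
  have hsrc := φ.open_source.measurableSet
  have hφr : (chartVolume f φ).restrict φ.source = chartVolume f φ :=
    Measure.restrict_eq_self_of_ae_mem (mem_ae_iff.2 (chartVolume_apply_compl_source f φ))
  have hle : ∀ ψ ∈ atlas (Euc n) M, chartVolume f ψ ≤ riemannianVolume f := fun ψ hψ =>
    le_iSup₂ (f := fun ψ (_ : ψ ∈ atlas (Euc n) M) => chartVolume f ψ) ψ hψ
  refine le_antisymm ?_ ?_
  · have hup : riemannianVolume f ≤ chartVolume f φ + (riemannianVolume f).restrict φ.sourceᶜ := by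
      refine iSup₂_le fun ψ hψ => ?_
      rw [← Measure.restrict_add_restrict_compl (μ := chartVolume f ψ) hsrc]
      refine add_le_add ?_ (Measure.restrict_mono subset_rfl (hle ψ hψ))
      refine Measure.le_iff.2 fun s hs => ?_
      rw [Measure.restrict_apply hs]
      have h1 : chartVolume f ψ (s ∩ φ.source) = chartVolume f ψ (s ∩ φ.source ∩ ψ.source) := by
        rw [← measure_inter_add_sdiff (s ∩ φ.source) ψ.open_source.measurableSet]
        have : chartVolume f ψ ((s ∩ φ.source) \ ψ.source) = 0 :=
          measure_mono_null (fun x hx => hx.2) (chartVolume_apply_compl_source f ψ)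
        rw [this, add_zero]
      rw [h1, chartVolume_inter_le hf hψ hφ ((hs.inter hsrc).inter ψ.open_source.measurableSet)
        (fun x hx => hx.2) (fun x hx => hx.1.2)]
      exact measure_mono fun x hx => hx.1.1
    calc (riemannianVolume f).restrict φ.source
        ≤ (chartVolume f φ + (riemannianVolume f).restrict φ.sourceᶜ).restrict φ.source :=
          Measure.restrict_mono subset_rfl hup
      _ = chartVolume f φ := by
          rw [Measure.restrict_add, hφr, Measure.restrict_restrict hsrc, inter_compl_self,
            Measure.restrict_empty, add_zero]
  · rw [← hφr]
    exact Measure.restrict_mono subset_rfl (hle φ hφ)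

theorem integral_chartVolume (hf : ContMDiff (𝓡 n) 𝓘(ℝ, Euc (n + 1)) ∞ f)
    (hinj : ∀ p, Function.Injective (differential f p)) (hφ : φ ∈ atlas (Euc n) M)
    {G : M → ℝ} (hG : Continuous G) :
    ∫ p, G p ∂(chartVolume f φ) =
      ∫ y in φ.target, areaDensity (fderiv ℝ (f ∘ φ.symm) y) * G (φ.symm y) := by
  have hmeas : AEMeasurable (fun y => ENNReal.ofReal (volumeDensity f φ y))
      ((volume : Measure (Euc n)).restrict φ.target) := by
    refine (ContinuousOn.aemeasurable ?_ φ.open_target.measurableSet).ennreal_ofReal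
    intro y hy
    have hF := (contDiffOn_comp_chart_symm hφ le_rfl hf).contDiffAt (φ.open_target.mem_nhds hy)
    exact (contDiffAt_areaDensity (k := 0) (hF.fderiv_right (m := 0) (by simp))
      (injective_fderiv_chart hf hinj hφ hy)).continuousAt.continuousWithinAt
  rw [chartVolume, integral_map
    ((aemeasurable_chart_symm φ).mono_ac (withDensity_absolutelyContinuous _ _))
    hG.measurable.aestronglyMeasurable,
    integral_withDensity_eq_integral_toReal_smul₀ hmeas (by simp)]
  refine integral_congr_ae (Eventually.of_forall fun y => ?_)
  simp only [smul_eq_mul]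
  rw [ENNReal.toReal_ofReal (show 0 ≤ volumeDensity f φ y from Real.sqrt_nonneg _)]
  rfl

theorem chartVolume_smul_sub (hf : ContMDiff (𝓡 n) 𝓘(ℝ, Euc (n + 1)) ∞ f)
    (hφ : φ ∈ atlas (Euc n) M) {c : ℝ} (hc : 0 ≤ c) (v : Euc (n + 1)) :
    chartVolume (fun p => c • f p - v) φ = ENNReal.ofReal (c ^ n) • chartVolume f φ := by
  refine Measure.ext fun s hs => ?_
  rw [chartVolume_apply _ φ hs, Measure.smul_apply, chartVolume_apply _ φ hs, smul_eq_mul,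
    ← lintegral_const_mul' _ _ ENNReal.ofReal_ne_top]
  refine setLIntegral_congr_fun (measurableSet_target_inter_preimage φ hs) fun y hy => ?_
  have hFd : DifferentiableAt ℝ (f ∘ φ.symm) y :=
    ((contDiffOn_comp_chart_symm hφ le_rfl hf).contDiffAt
      (φ.open_target.mem_nhds hy.1)).differentiableAt (by simp)
  have : fderiv ℝ ((fun p => c • f p - v) ∘ φ.symm) y = c • fderiv ℝ (f ∘ φ.symm) y :=
    ((hFd.hasFDerivAt.const_smul c).sub_const v).fderiv
  rw [this, areaDensity_smul _ hc, ENNReal.ofReal_mul (by positivity)]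

theorem riemannianVolume_smul_sub (hf : ContMDiff (𝓡 n) 𝓘(ℝ, Euc (n + 1)) ∞ f)
    {c : ℝ} (hc : 0 < c) (v : Euc (n + 1)) :
    riemannianVolume (fun p => c • f p - v) = ENNReal.ofReal (c ^ n) • riemannianVolume f := by
  have hg : ContMDiff (𝓡 n) 𝓘(ℝ, Euc (n + 1)) ∞ (fun p => c • f p - v) :=
    (((contDiff_const_smul c).sub contDiff_const).contMDiff (n := ∞)
      (f := fun x : Euc (n + 1) => c • x - v)).comp hf
  have hle : ∀ {g : M → Euc (n + 1)}, ContMDiff (𝓡 n) 𝓘(ℝ, Euc (n + 1)) ∞ g → ∀ {d : ℝ}, 0 ≤ d →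
      ∀ w, riemannianVolume (fun p => d • g p - w) ≤ ENNReal.ofReal (d ^ n) • riemannianVolume g := by
    intro g hg d hd w
    refine iSup₂_le fun φ hφ => ?_
    rw [chartVolume_smul_sub hg hφ hd]
    have : chartVolume g φ ≤ riemannianVolume g :=
      le_iSup₂ (f := fun ψ (_ : ψ ∈ atlas (Euc n) M) => chartVolume g ψ) φ hφ
    refine Measure.le_iff.2 fun s _ => ?_
    simp only [Measure.smul_apply, smul_eq_mul]
    gcongr
  refine le_antisymm (hle hf hc.le v) ?_
  -- The reverse inequality is the first one applied to the inverse homothety.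
  have h2 := hle hg (inv_nonneg.2 hc.le) (-(c⁻¹ • v))
  have h3 : (fun p => c⁻¹ • (c • f p - v) - -(c⁻¹ • v)) = f := by
    ext1 p
    rw [smul_sub, smul_smul, inv_mul_cancel₀ hc.ne']
    simp
  rw [h3] at h2
  refine Measure.le_iff.2 fun s _ => ?_
  have h4 := h2 s
  simp only [Measure.smul_apply, smul_eq_mul] at h4 ⊢
  calc ENNReal.ofReal (c ^ n) * riemannianVolume f s
      ≤ ENNReal.ofReal (c ^ n) * (ENNReal.ofReal (c⁻¹ ^ n) *
        riemannianVolume (fun p => c • f p - v) s) := by gcongr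
    _ = _ := by
      rw [← mul_assoc, ← ENNReal.ofReal_mul (by positivity), ← mul_pow, mul_inv_cancel₀ hc.ne']
      simp

end Volume

/-! ### The divergence theorem on the whole hypersurface. -/

section GlobalDivergence

variable {n : ℕ} {M : Type*} [TopologicalSpace M] [ChartedSpace (Euc n) M]
  [IsManifold (𝓡 n) ∞ M] {φ : OpenPartialHomeomorph M (Euc n)} {f ν : M → Euc (n + 1)}

/-- A function with small slope for the intrinsic distance has small variation along the segments of
a chart. -/
theorem abs_sub_le_of_segment_chart (hf : ContMDiff (𝓡 n) 𝓘(ℝ, Euc (n + 1)) ∞ f)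
    (hφ : φ ∈ atlas (Euc n) M) {η : M → ℝ} {ε : ℝ} (hε : 0 ≤ ε)
    (hη : ∀ p q, ENNReal.ofReal |η p - η q| ≤ ENNReal.ofReal ε * intrinsicEDist f p q)
    (y v : Euc n) (c : ℝ) (h : ∀ t ∈ Icc (0 : ℝ) 1, y + t • v ∈ φ.target ∧
      ‖fderiv ℝ (f ∘ φ.symm) (y + t • v) v‖ ≤ c) :
    |(η ∘ φ.symm) (y + v) - (η ∘ φ.symm) y| ≤ ε * c := by
  have hc : 0 ≤ c := (norm_nonneg _).trans (h 0 (by simp)).2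
  have hline : ContDiff ℝ ∞ fun t : ℝ => y + t • v := by fun_prop
  have hγ : ContMDiffOn 𝓘(ℝ, ℝ) (𝓡 n) 1 (fun t : ℝ => φ.symm (y + t • v)) (Icc 0 1) :=
    ((contMDiffOn_chart_symm hφ).of_le (one_le_two.trans two_le_infty)).comp
      (hline.of_le (one_le_two.trans two_le_infty)).contMDiff.contMDiffOn fun t ht => (h t ht).1
  have hd : intrinsicEDist f (φ.symm y) (φ.symm (y + v)) ≤ ENNReal.ofReal c := by
    have h0 : intrinsicEDist f (φ.symm y) (φ.symm (y + v)) ≤ ∫⁻ t in Icc (0 : ℝ) 1,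
        ‖derivWithin (f ∘ fun t : ℝ => φ.symm (y + t • v)) (Icc 0 1) t‖ₑ :=
      iInf_le_of_le (fun t : ℝ => φ.symm (y + t • v)) (iInf_le_of_le hγ (iInf_le_of_le (by simp)
        (iInf_le_of_le (by simp) le_rfl)))
    refine h0.trans ?_
    have hle : ∀ t ∈ Icc (0 : ℝ) 1,
        ‖derivWithin (f ∘ fun t : ℝ => φ.symm (y + t • v)) (Icc 0 1) t‖ₑ ≤ ENNReal.ofReal c := by
      intro t ht
      have hFd : DifferentiableAt ℝ (f ∘ φ.symm) (y + t • v) :=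
        ((contDiffOn_comp_chart_symm hφ le_rfl hf).contDiffAt
          (φ.open_target.mem_nhds (h t ht).1)).differentiableAt (by simp)
      have hl : HasDerivAt (fun t : ℝ => y + t • v) v t := by
        simpa using ((hasDerivAt_id t).smul_const v).const_add y
      have hD := (hFd.hasFDerivAt.comp_hasDerivAt t hl).hasDerivWithinAt (s := Icc 0 1)
      have hD' : derivWithin (f ∘ fun t : ℝ => φ.symm (y + t • v)) (Icc 0 1) t =
        fderiv ℝ (f ∘ φ.symm) (y + t • v) v := hD.derivWithin (uniqueDiffOn_Icc zero_lt_one t ht)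
      rw [hD', ← ofReal_norm]
      exact ENNReal.ofReal_le_ofReal (h t ht).2
    refine (setLIntegral_mono measurable_const hle).trans ?_
    simp
  have h2 := (hη (φ.symm y) (φ.symm (y + v))).trans (mul_le_mul_right hd _)
  rw [← ENNReal.ofReal_mul hε] at h2
  rw [abs_sub_comm]
  exact (ENNReal.ofReal_le_ofReal_iff (by positivity)).1 h2

omit [IsManifold (𝓡 n) ∞ M] in
theorem tangentialDeriv_eq_zero {ρ : M → ℝ} {p : M} {c : ℝ} (h : ρ =ᶠ[𝓝 p] fun _ => c)
    (Φ : Euc (n + 1) → Euc (n + 1)) : tangentialDeriv f Φ ρ p = 0 := by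
  have : mderiv (n := n) ρ p = 0 := by
    have h1 : mfderiv (𝓡 n) 𝓘(ℝ, ℝ) ρ p = mfderiv (𝓡 n) 𝓘(ℝ, ℝ) (fun _ : M => c) p :=
      h.mfderiv_eq
    exact h1.trans mfderiv_const
  rw [tangentialDeriv, this]
  rfl

omit [IsManifold (𝓡 n) ∞ M] in
theorem mderiv_finsetSum {ι : Type*} (T : Finset ι) {ρ : ι → M → ℝ} {p : M}
    (hρ : ∀ i, MDifferentiableAt (𝓡 n) 𝓘(ℝ, ℝ) (ρ i) p) :
    mderiv (n := n) (∑ i ∈ T, ρ i) p = ∑ i ∈ T, mderiv (ρ i) p := by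
  classical
  suffices h : HasMFDerivAt (𝓡 n) 𝓘(ℝ, ℝ) (∑ i ∈ T, ρ i) p
      (∑ i ∈ T, mderiv (ρ i) p : Euc n →L[ℝ] ℝ) from h.mfderiv
  induction T using Finset.induction_on with
  | empty =>
    simp only [Finset.sum_empty]
    exact hasMFDerivAt_const (0 : ℝ) p
  | insert i T hi ih =>
    rw [Finset.sum_insert hi, Finset.sum_insert hi]
    exact (hρ i).hasMFDerivAt.add ih

variable [MeasurableSpace M] [BorelSpace M]

theorem integral_riemannianVolume_of_support (hf : ContMDiff (𝓡 n) 𝓘(ℝ, Euc (n + 1)) ∞ f)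
    (hinj : ∀ p, Function.Injective (differential f p)) (hφ : φ ∈ atlas (Euc n) M)
    {G : M → ℝ} (hG : Continuous G) (hsupp : ∀ p, p ∉ φ.source → G p = 0) :
    ∫ p, G p ∂(riemannianVolume f) =
      ∫ y in φ.target, areaDensity (fderiv ℝ (f ∘ φ.symm) y) * G (φ.symm y) := by
  rw [← integral_chartVolume hf hinj hφ hG, ← riemannianVolume_restrict_source hf hφ,
    setIntegral_eq_integral_of_forall_compl_eq_zero hsupp]

/-- The integrand is `η` times `div (ρ Φ^T) = dρ(Φ^T) + ρ div Φ^T`. As `ρ` lives in one chart, this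
is the patch estimate read in coordinates. -/
theorem abs_integral_chart_le (hf : ContMDiff (𝓡 n) 𝓘(ℝ, Euc (n + 1)) ∞ f)
    (hinj : ∀ p, Function.Injective (differential f p)) (hν : IsUnitNormal f ν)
    (hφ : φ ∈ atlas (Euc n) M) {ρ : M → ℝ} (hρ : ContMDiff (𝓡 n) 𝓘(ℝ, ℝ) 1 ρ)
    (hρc : HasCompactSupport ρ) (hρφ : tsupport ρ ⊆ φ.source) (hρ0 : ∀ p, 0 ≤ ρ p)
    {Φ : Euc (n + 1) → Euc (n + 1)} (hΦ : ContDiff ℝ 1 Φ) (hdiv : Continuous (tangentialDiv f ν Φ))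
    {η : M → ℝ} (hηc : Continuous η) {ε : ℝ} (hε : 0 ≤ ε)
    (hη : ∀ p q, ENNReal.ofReal |η p - η q| ≤ ENNReal.ofReal ε * intrinsicEDist f p q) :
    |∫ p, η p * (tangentialDeriv f Φ ρ p + ρ p * tangentialDiv f ν Φ p) ∂(riemannianVolume f)| ≤
      ε * ∫ p, ρ p * ‖Φ (f p)‖ ∂(riemannianVolume f) := by
  -- Outside its target the inverse chart carries no information, so `ρ` is extended by zero. The
  -- extension stays `C¹` because its support lies in the compact set `C` inside the target.
  set r : Euc n → ℝ := φ.target.indicator (ρ ∘ φ.symm) with hr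
  set C : Set (Euc n) := φ '' tsupport ρ with hC
  have hCc : IsCompact C := hρc.isCompact.image_of_continuousOn (φ.continuousOn.mono hρφ)
  have hCt : C ⊆ φ.target := by
    rintro _ ⟨p, hp, rfl⟩
    exact φ.map_source (hρφ hp)
  have hsupp : tsupport r ⊆ C := by
    refine closure_minimal (fun y hy => ?_) hCc.isClosed
    have hyt : y ∈ φ.target := mem_of_indicator_ne_zero hy
    rw [Function.mem_support, hr, indicator_of_mem hyt] at hy
    exact ⟨φ.symm y, subset_tsupport _ hy, φ.right_inv hyt⟩
  have hr_eq : ∀ y ∈ φ.target, r =ᶠ[𝓝 y] ρ ∘ φ.symm := fun y hy =>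
    eventuallyEq_of_mem (φ.open_target.mem_nhds hy) fun z hz => indicator_of_mem hz _
  have hrcd : ContDiff ℝ 1 r := by
    rw [contDiff_iff_contDiffAt]
    intro y
    by_cases hy : y ∈ φ.target
    · exact ((contDiffOn_comp_chart_symm hφ (one_le_two.trans two_le_infty) hρ).contDiffAt
        (φ.open_target.mem_nhds hy)).congr_of_eventuallyEq (hr_eq y hy)
    · exact contDiffAt_const.congr_of_eventuallyEq
        (notMem_tsupport_iff_eventuallyEq.1 fun hy' => hy (hCt (hsupp hy')))
  have hr0 : ∀ y, 0 ≤ r y := fun y => indicator_nonneg (fun z _ => hρ0 _) y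
  have key := abs_integral_patch_le φ.open_target (contDiffOn_comp_chart_symm hφ le_rfl hf)
    (fun y hy => injective_fderiv_chart hf hinj hφ hy)
    (contDiffOn_comp_chart_symm hφ le_rfl hν.smooth) (fun y _ => hν.norm_eq_one _)
    (fun y hy v => by
      rw [fderiv_immersion_chart hf hφ hy]
      exact hν.orthogonal _ _)
    hrcd (hCc.of_isClosed_subset (isClosed_tsupport _) hsupp) (hsupp.trans hCt) hr0 hΦ hε
    (abs_sub_le_of_segment_chart hf hφ hε hη)
  have hz : ∀ p, p ∉ tsupport ρ → ρ p = 0 ∧ tangentialDeriv f Φ ρ p = 0 := fun p hp =>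
    ⟨image_eq_zero_of_notMem_tsupport hp,
      tangentialDeriv_eq_zero (notMem_tsupport_iff_eventuallyEq.1 hp) Φ⟩
  have hρcont := hρ.continuous
  have hfc := hf.continuous
  have e1 := integral_riemannianVolume_of_support hf hinj hφ
    (G := fun p => η p * (tangentialDeriv f Φ ρ p + ρ p * tangentialDiv f ν Φ p))
    (hηc.mul ((continuous_tangentialDeriv hf hinj hρ hΦ).add (hρcont.mul hdiv)))
    (fun p hp => by
      obtain ⟨h1, h2⟩ := hz p fun h => hp (hρφ h)
      simp [h1, h2])
  have e2 := integral_riemannianVolume_of_support hf hinj hφ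
    (G := fun p => ρ p * ‖Φ (f p)‖) (hρcont.mul (hΦ.continuous.comp hfc).norm)
    (fun p hp => by simp [(hz p fun h => hp (hρφ h)).1])
  have hout : ∀ y, y ∉ φ.target → r y = 0 ∧ fderiv ℝ r y = 0 := by
    intro y hy
    have hy' : y ∉ tsupport r := fun h => hy (hCt (hsupp h))
    refine ⟨image_eq_zero_of_notMem_tsupport hy', ?_⟩
    by_contra h0
    exact hy' (support_fderiv_subset ℝ h0)
  rw [← setIntegral_eq_integral_of_forall_compl_eq_zero (s := φ.target),
    ← setIntegral_eq_integral_of_forall_compl_eq_zero (s := φ.target)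
      (f := fun y => areaDensity (fderiv ℝ (f ∘ φ.symm) y) * (r y * ‖Φ ((f ∘ φ.symm) y)‖))] at key
  · rw [e1, e2]
    convert key using 2
    · refine setIntegral_congr_fun φ.open_target.measurableSet fun y hy => ?_
      rw [tangentialDiv_chart hf hinj hν.smooth hφ Φ hy, Filter.EventuallyEq.fderiv_eq (𝕜 := ℝ) (hr_eq y hy),
        tangentialDeriv_chart hf hinj hφ hρ Φ hy, (hr_eq y hy).self_of_nhds]
      simp only [Function.comp_apply]
      ring
    · refine setIntegral_congr_fun φ.open_target.measurableSet fun y hy => ?_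
      rw [(hr_eq y hy).self_of_nhds]
      rfl
  · intro y hy
    simp [(hout y hy).1]
  · intro y hy
    simp [(hout y hy).1, (hout y hy).2]

variable [T2Space M] [SecondCountableTopology M]

/-- The divergence theorem on an immersed hypersurface, tested against a compactly supported
function whose slope for the intrinsic distance is at most `ε`. -/
theorem abs_integral_mul_tangentialDiv_le (hf : ContMDiff (𝓡 n) 𝓘(ℝ, Euc (n + 1)) ∞ f)
    (hinj : ∀ p, Function.Injective (differential f p)) (hν : IsUnitNormal f ν)
    [IsFiniteMeasureOnCompacts (riemannianVolume f)]
    {Φ : Euc (n + 1) → Euc (n + 1)} (hΦ : ContDiff ℝ 1 Φ) (hdiv : Continuous (tangentialDiv f ν Φ))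
    (hΦi : Integrable (fun p => ‖Φ (f p)‖) (riemannianVolume f))
    {η : M → ℝ} (hηc : Continuous η) (hηs : HasCompactSupport η) {ε : ℝ} (hε : 0 ≤ ε)
    (hη : ∀ p q, ENNReal.ofReal |η p - η q| ≤ ENNReal.ofReal ε * intrinsicEDist f p q) :
    |∫ p, η p * tangentialDiv f ν Φ p ∂(riemannianVolume f)| ≤
      ε * ∫ p, ‖Φ (f p)‖ ∂(riemannianVolume f) := by
  have : LocallyCompactSpace M := ChartedSpace.locallyCompactSpace (Euc n) M
  have hU : ∀ p : M, ∃ K : Set M, IsCompact K ∧ p ∈ interior K ∧ K ⊆ (chartAt (Euc n) p).source :=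
    fun p => exists_compact_subset (chartAt (Euc n) p).open_source (mem_chart_source _ p)
  choose K hKc hpK hKs using hU
  obtain ⟨ρ, hρ⟩ := SmoothPartitionOfUnity.exists_isSubordinate (𝓡 n) (isClosed_univ (X := M))
    (fun p => interior (K p)) (fun p => isOpen_interior)
    (fun p _ => mem_iUnion.2 ⟨p, hpK p⟩)
  -- Only finitely many members of the partition meet the support of `η`, so all the sums are
  -- finite.
  have hfin := ρ.locallyFinite.finite_nonempty_inter_compact hηs.isCompact
  set T := hfin.toFinset with hT
  have hρK : ∀ i, tsupport (ρ i) ⊆ K i := fun i => (hρ i).trans interior_subset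
  have hρcs : ∀ i, HasCompactSupport (ρ i) := fun i =>
    (hKc i).of_isClosed_subset (isClosed_tsupport _) (hρK i)
  have hsum : ∀ p ∈ tsupport η, ∑ i ∈ T, ρ i p = 1 := by
    intro p hp
    rw [← ρ.sum_eq_one (mem_univ p)]
    refine (finsum_eq_sum_of_support_subset _ fun i hi => ?_).symm
    rw [hT, Finite.coe_toFinset]
    exact ⟨p, hi, hp⟩
  have hρ1 : ∀ i, ContMDiff (𝓡 n) 𝓘(ℝ, ℝ) 1 (ρ i) := fun i =>
    (ρ i).contMDiff.of_le (one_le_two.trans two_le_infty)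
  -- Near a point where `η ≠ 0` the functions `ρ i` sum to 1, so the terms `dρ(Φ^T)` created by the
  -- localization cancel.
  have hder : ∀ p, η p ≠ 0 → ∑ i ∈ T, tangentialDeriv f Φ (ρ i) p = 0 := by
    intro p hp
    have hev : (∑ i ∈ T, (ρ i : M → ℝ)) =ᶠ[𝓝 p] fun _ => 1 := by
      refine eventuallyEq_of_mem ((isOpen_ne.preimage hηc).mem_nhds hp) fun q hq => ?_
      rw [Finset.sum_apply]
      exact hsum q (subset_tsupport _ hq)
    rw [← tangentialDeriv_eq_zero (f := f) hev Φ]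
    have h2 := mderiv_finsetSum T fun i => (hρ1 i p).mdifferentiableAt one_ne_zero
    simp only [tangentialDeriv]
    rw [h2, sum_apply]
  have hdec : ∀ p, η p * tangentialDiv f ν Φ p = ∑ i ∈ T, η p *
      (tangentialDeriv f Φ (ρ i) p + ρ i p * tangentialDiv f ν Φ p) := by
    intro p
    rw [← Finset.mul_sum, Finset.sum_add_distrib, ← Finset.sum_mul]
    by_cases hp : η p = 0
    · simp [hp]
    · rw [hder p hp, hsum p (subset_tsupport _ hp), zero_add, one_mul]
  have hint : ∀ i ∈ T, Integrable (fun p => η p *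
      (tangentialDeriv f Φ (ρ i) p + ρ i p * tangentialDiv f ν Φ p)) (riemannianVolume f) :=
    fun i _ => (hηc.mul ((continuous_tangentialDeriv hf hinj (hρ1 i) hΦ).add
      ((hρ1 i).continuous.mul hdiv))).integrable_of_hasCompactSupport hηs.mul_right
  have hfc := hf.continuous
  have hint2 : ∀ i ∈ T, Integrable (fun p => ρ i p * ‖Φ (f p)‖) (riemannianVolume f) :=
    fun i _ => ((hρ1 i).continuous.mul
      (hΦ.continuous.comp hfc).norm).integrable_of_hasCompactSupport (hρcs i).mul_right
  simp_rw [hdec]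
  rw [integral_finsetSum _ hint]
  refine (Finset.abs_sum_le_sum_abs _ _).trans ?_
  calc ∑ i ∈ T, |∫ p, η p * (tangentialDeriv f Φ (ρ i) p + ρ i p * tangentialDiv f ν Φ p)
        ∂(riemannianVolume f)|
      ≤ ∑ i ∈ T, ε * ∫ p, ρ i p * ‖Φ (f p)‖ ∂(riemannianVolume f) :=
        Finset.sum_le_sum fun i _ => abs_integral_chart_le hf hinj hν (chart_mem_atlas (Euc n) i)
          (hρ1 i) (hρcs i) ((hρK i).trans (hKs i)) (fun p => ρ.nonneg i p) hΦ hdiv hηc hε hη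
    _ = ε * ∫ p, ∑ i ∈ T, ρ i p * ‖Φ (f p)‖ ∂(riemannianVolume f) := by
        rw [← Finset.mul_sum, integral_finsetSum _ hint2]
    _ ≤ _ := by
        -- The patch errors are weighted by `ρ i`, so they add up to at most one `ε ∫ ‖Φ‖`, however
        -- many patches there are.
        refine mul_le_mul_of_nonneg_left (integral_mono (integrable_finsetSum _ hint2) hΦi
          fun p => ?_) hε
        dsimp only
        rw [← Finset.sum_mul]
        refine mul_le_of_le_one_left (norm_nonneg _) ?_
        refine le_trans ?_ (ρ.sum_le_one p)
        rw [finsum_eq_sum _ (ρ.locallyFinite.point_finite p)]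
        rw [← Finset.sum_filter_ne_zero]
        exact Finset.sum_le_sum_of_subset_of_nonneg
          (fun i hi => (Set.Finite.mem_toFinset _).2 (Finset.mem_filter.1 hi).2) fun i _ _ => ρ.nonneg i p

end GlobalDivergence

/-! ### The moving Gaussian and the field `K Z`. -/

section Kernel

variable {n : ℕ}

/-- The Gaussian density `(4πt)^{-n/2} exp (-‖x - x₀‖² / (4t))`. -/
def gaussianKernel (x₀ : Euc (n + 1)) (t : ℝ) (x : Euc (n + 1)) : ℝ :=
  1 / (4 * Real.pi * t) ^ ((n : ℝ) / 2) * Real.exp (-(‖x - x₀‖ ^ 2 / (4 * t)))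

theorem gaussianKernel_pos (x₀ : Euc (n + 1)) {t : ℝ} (ht : 0 < t) (x : Euc (n + 1)) :
    0 < gaussianKernel x₀ t x := by
  unfold gaussianKernel
  positivity

theorem contDiff_gaussianKernel (x₀ : Euc (n + 1)) (t : ℝ) :
    ContDiff ℝ ∞ (gaussianKernel x₀ t) :=
  contDiff_const.mul (((contDiff_id.sub contDiff_const).norm_sq ℝ).div_const _).neg.exp

theorem continuous_gaussianKernel (x₀ : Euc (n + 1)) (t : ℝ) :
    Continuous (gaussianKernel x₀ t) := (contDiff_gaussianKernel x₀ t).continuous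

/-- The Gaussian density centred at `x₁ + s e_{n+1}` at the scale `s`. -/
def movingKernel (x₁ : Euc (n + 1)) (s : ℝ) (x : Euc (n + 1)) : ℝ :=
  gaussianKernel (x₁ + s • eTop n) s x

/-- The vector field `(x - x₁ - s e_{n+1}) / (2s) + e_{n+1}`. -/
def driftField (x₁ : Euc (n + 1)) (s : ℝ) (x : Euc (n + 1)) : Euc (n + 1) :=
  (2 * s)⁻¹ • (x - (x₁ + s • eTop n)) + eTop n

/-- The derivative of `movingKernel` with respect to `s`. -/
def movingKernelDeriv (x₁ : Euc (n + 1)) (s : ℝ) (x : Euc (n + 1)) : ℝ :=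
  movingKernel x₁ s x * ((2 * s)⁻¹ * (inner ℝ (x - (x₁ + s • eTop n)) (driftField x₁ s x) - n))

theorem norm_eTop : ‖eTop n‖ = 1 := by simp [eTop, basisVec]

/-- With the power of `s` moved into the exponent, the derivative in `s` is `K` times that of an
elementary function. -/
theorem movingKernel_eq_exp (x₁ : Euc (n + 1)) {s : ℝ} (hs : 0 < s) (x : Euc (n + 1)) :
    movingKernel x₁ s x = Real.exp (-((n : ℝ) / 2 * Real.log (4 * Real.pi * s)) -
      ‖x - (x₁ + s • eTop n)‖ ^ 2 / (4 * s)) := by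
  have h : 0 < 4 * Real.pi * s := by positivity
  rw [movingKernel, gaussianKernel, Real.rpow_def_of_pos h, one_div, ← Real.exp_neg, ← Real.exp_add]
  congr 1
  ring

theorem hasDerivAt_movingKernel (x₁ : Euc (n + 1)) {s : ℝ} (hs : 0 < s) (x : Euc (n + 1)) :
    HasDerivAt (fun s => movingKernel x₁ s x) (movingKernelDeriv x₁ s x) s := by
  have hpi := Real.pi_pos
  have hlog : HasDerivAt (fun s : ℝ => Real.log (4 * Real.pi * s)) s⁻¹ s := by
    have h1 := ((hasDerivAt_id s).const_mul (4 * Real.pi)).log (by simp; positivity)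
    refine h1.congr_deriv ?_
    simp only [id]
    field_simp
  have hX : HasDerivAt (fun s : ℝ => x - (x₁ + s • eTop n)) (-eTop n) s := by
    simpa using (((hasDerivAt_id s).smul_const (eTop n)).const_add x₁).const_sub x
  have hd := ((hlog.const_mul ((n : ℝ) / 2)).neg.sub
    (hX.norm_sq.div ((hasDerivAt_id s).const_mul 4) (by simp; positivity))).exp
  have heq : (fun s => movingKernel x₁ s x) =ᶠ[𝓝 s] fun s =>
      Real.exp (-((n : ℝ) / 2 * Real.log (4 * Real.pi * s)) -
        ‖x - (x₁ + s • eTop n)‖ ^ 2 / (4 * s)) :=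
    (eventually_gt_nhds hs).mono fun r hr => movingKernel_eq_exp x₁ hr x
  refine (HasDerivAt.congr_of_eventuallyEq hd heq).congr_deriv ?_
  rw [movingKernelDeriv, movingKernel_eq_exp x₁ hs x]
  congr 1
  rw [driftField, inner_add_right, inner_smul_right, real_inner_self_eq_norm_sq]
  simp only [id, inner_neg_right]
  field_simp
  ring

theorem continuousOn_movingKernelDeriv (x₁ : Euc (n + 1)) :
    ContinuousOn (fun q : ℝ × Euc (n + 1) => movingKernelDeriv x₁ q.1 q.2) {q | 0 < q.1} := by
  have h1 : ContinuousOn (fun q : ℝ × Euc (n + 1) => movingKernel x₁ q.1 q.2) {q | 0 < q.1} := by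
    refine ContinuousOn.congr (f := fun q : ℝ × Euc (n + 1) =>
      Real.exp (-((n : ℝ) / 2 * Real.log (4 * Real.pi * q.1)) -
        ‖q.2 - (x₁ + q.1 • eTop n)‖ ^ 2 / (4 * q.1))) ?_
      fun q hq => movingKernel_eq_exp x₁ hq q.2
    intro q hq
    have hq' : q.1 ≠ 0 := ne_of_gt hq
    have hp : 4 * Real.pi * q.1 ≠ 0 := by have := Real.pi_ne_zero; positivity
    have hp' : 4 * q.1 ≠ 0 := by positivity
    refine ContinuousAt.continuousWithinAt ?_
    have hl : ContinuousAt (fun q : ℝ × Euc (n + 1) => Real.log (4 * Real.pi * q.1)) q :=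
      ContinuousAt.log (by fun_prop) hp
    have hn : ContinuousAt (fun q : ℝ × Euc (n + 1) =>
      ‖q.2 - (x₁ + q.1 • eTop n)‖ ^ 2 / (4 * q.1)) q := ContinuousAt.div (by fun_prop) (by fun_prop) hp'
    fun_prop
  have h2 : ContinuousOn (fun q : ℝ × Euc (n + 1) => (2 * q.1)⁻¹) {q | 0 < q.1} := by
    refine ContinuousOn.inv₀ (by fun_prop) fun q hq => ?_
    have : 0 < q.1 := hq
    positivity
  unfold movingKernelDeriv driftField
  refine h1.mul (h2.mul (ContinuousOn.sub (ContinuousOn.inner (by fun_prop) ?_) continuousOn_const))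
  exact (h2.smul (by fun_prop)).add continuousOn_const

/-- The vector field `K Z`, for the kernel `K = movingKernel` and the field `Z = driftField`. -/
def kernelField (x₁ : Euc (n + 1)) (s : ℝ) (x : Euc (n + 1)) : Euc (n + 1) :=
  movingKernel x₁ s x • driftField x₁ s x

theorem contDiff_driftField (x₁ : Euc (n + 1)) (s : ℝ) : ContDiff ℝ ∞ (driftField x₁ s) := by
  unfold driftField
  fun_prop

theorem contDiff_kernelField (x₁ : Euc (n + 1)) (s : ℝ) : ContDiff ℝ ∞ (kernelField x₁ s) :=
  (contDiff_gaussianKernel _ _).smul (contDiff_driftField _ _)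

/-- Product rule with `DK[v] = -K ⟪X, v⟫ / (2s)` and `DZ[v] = v / (2s)`, where `X = x - x₁ - s
e_{n+1}`. -/
theorem fderiv_kernelField (x₁ : Euc (n + 1)) (s : ℝ) (x v : Euc (n + 1)) :
    fderiv ℝ (kernelField x₁ s) x v = (movingKernel x₁ s x * (2 * s)⁻¹) • v -
      (movingKernel x₁ s x * (2 * s)⁻¹ * inner ℝ (x - (x₁ + s • eTop n)) v) •
        driftField x₁ s x := by
  have hX : HasFDerivAt (fun x : Euc (n + 1) => x - (x₁ + s • eTop n))
      (ContinuousLinearMap.id ℝ (Euc (n + 1))) x := (hasFDerivAt_id x).sub_const _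
  have hK : HasFDerivAt (movingKernel x₁ s) _ x :=
    ((hX.norm_sq.mul_const (4 * s)⁻¹).neg.exp).const_mul (1 / (4 * Real.pi * s) ^ ((n : ℝ) / 2))
  have hZ : HasFDerivAt (driftField x₁ s) _ x := (hX.const_smul (2 * s)⁻¹).add_const (eTop n)
  rw [HasFDerivAt.fderiv (f := kernelField x₁ s) (hK.smul hZ)]
  have h : ∀ X : Euc (n + 1), (1 / (4 * Real.pi * s) ^ ((n : ℝ) / 2)) *
      (Real.exp (-(‖X‖ ^ 2 * (4 * s)⁻¹)) * -((4 * s)⁻¹ * (2 * inner ℝ X v))) =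
      -(1 / (4 * Real.pi * s) ^ ((n : ℝ) / 2) * Real.exp (-(‖X‖ ^ 2 / (4 * s))) * (2 * s)⁻¹ *
        inner ℝ X v) := by
    intro X
    rw [mul_inv 4 s, mul_inv 2 s, div_eq_mul_inv (‖X‖ ^ 2), mul_inv 4 s]
    ring
  change movingKernel x₁ s x • ((2 * s)⁻¹ • v) + ((1 / (4 * Real.pi * s) ^ ((n : ℝ) / 2)) *
    (Real.exp (-(‖x - (x₁ + s • eTop n)‖ ^ 2 * (4 * s)⁻¹)) *
      -((4 * s)⁻¹ * (2 • inner ℝ (x - (x₁ + s • eTop n)) v)))) • driftField x₁ s x = _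
  rw [two_nsmul, ← two_mul, h, neg_smul, ← sub_eq_add_neg, smul_smul]
  rfl

/-- The multiple of the identity contributes `n`, and the rank-one part contributes `⟪X, Z^T⟫ = ⟪X,
Z⟫ - ⟪ν, Z⟫ ⟪ν, X⟫`. -/
theorem tangentialTrace_kernelField {L : Euc n →L[ℝ] Euc (n + 1)} (hL : Function.Injective L)
    {ν : Euc (n + 1)} (h1 : ‖ν‖ = 1) (h2 : ∀ v, inner ℝ ν (L v) = 0) (x₁ : Euc (n + 1)) (s : ℝ)
    (x : Euc (n + 1)) :
    tangentialTrace L ((fderiv ℝ (kernelField x₁ s) x).comp L) = movingKernel x₁ s x * (2 * s)⁻¹ *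
      (n - (inner ℝ (x - (x₁ + s • eTop n)) (driftField x₁ s x) -
        inner ℝ ν (driftField x₁ s x) * inner ℝ ν (x - (x₁ + s • eTop n)))) := by
  set X := x - (x₁ + s • eTop n)
  set Z := driftField x₁ s x
  set c := movingKernel x₁ s x * (2 * s)⁻¹
  have hdec : pinv L ∘ₗ ((fderiv ℝ (kernelField x₁ s) x).comp L : Euc n →ₗ[ℝ] Euc (n + 1)) =
      c • LinearMap.id - c • (((innerSL ℝ X).comp L : Euc n →ₗ[ℝ] ℝ).smulRight (pinv L Z)) := by
    ext1 v
    have hv : v = pinv L (L v) := eq_pinv hL fun _ => rfl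
    have h := fderiv_kernelField x₁ s x (L v)
    change pinv L (fderiv ℝ (kernelField x₁ s) x (L v)) = c • v - c • ((inner ℝ X (L v) : ℝ) • pinv L Z)
    rw [h, map_sub, map_smul, map_smul, ← hv, smul_smul]
  rw [tangentialTrace]
  erw [hdec]
  rw [map_sub, map_smul, map_smul, LinearMap.trace_id, LinearMap.trace_smulRight]
  have h3 : ((innerSL ℝ X).comp L : Euc n →ₗ[ℝ] ℝ) (pinv L Z) = inner ℝ X (L (pinv L Z)) := rfl
  rw [h3, apply_pinv hL h1 h2, inner_sub_right, inner_smul_right, real_inner_comm ν X]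
  simp
  ring

end Kernel

/-! ### The pointwise identity behind monotonicity. -/

section Translater

variable {n : ℕ} {M : Type*} [TopologicalSpace M] [ChartedSpace (Euc n) M]
  {f ν : M → Euc (n + 1)}

/-- On a translater, `∂ₛ K = K ⟪ν, Z⟫² - div (K Z^T)`. -/
theorem tangentialDiv_kernelField (hinj : ∀ p, Function.Injective (differential f p))
    (hν : IsUnitNormal f ν) (hH : ∀ p, meanCurvature f ν p = -inner ℝ (ν p) (eTop n))
    (x₁ : Euc (n + 1)) (s : ℝ) (p : M) :
    tangentialDiv f ν (kernelField x₁ s) p =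
      movingKernel x₁ s (f p) * inner ℝ (ν p) (driftField x₁ s (f p)) ^ 2 -
        movingKernelDeriv x₁ s (f p) := by
  rw [tangentialDiv, tangentialTrace_kernelField (hinj p) (hν.norm_eq_one p) (hν.orthogonal p), hH,
    movingKernelDeriv, kernelField, inner_smul_right]
  have : inner ℝ (ν p) (driftField x₁ s (f p)) =
      (2 * s)⁻¹ * inner ℝ (ν p) (f p - (x₁ + s • eTop n)) + inner ℝ (ν p) (eTop n) := by
    rw [driftField, inner_add_right, inner_smul_right]
  -- Writing `H = -⟪ν, e_{n+1}⟫` through `Z` and `X` completes `⟪ν, Z⟫ ⟪ν, X⟫ / (2s)` to the square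
  -- `⟪ν, Z⟫²`.
  have h2 : inner ℝ (ν p) (eTop n) = inner ℝ (ν p) (driftField x₁ s (f p)) -
      (2 * s)⁻¹ * inner ℝ (ν p) (f p - (x₁ + s • eTop n)) := by rw [this]; ring
  rw [h2]
  ring

end Translater

/-! ### Bounds by the Gaussian at the doubled scale. -/

section GaussianBounds

variable {n : ℕ}

theorem gaussianArea_eq_lintegral (x₀ : Euc (n + 1)) {t : ℝ} (ht : 0 < t)
    (μ : Measure (Euc (n + 1))) :
    gaussianArea x₀ t μ = ∫⁻ x, ENNReal.ofReal (gaussianKernel x₀ t x) ∂μ := by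
  rw [gaussianArea, ← lintegral_const_mul _ (by fun_prop)]
  refine lintegral_congr fun x => ?_
  rw [gaussianKernel, ENNReal.ofReal_mul (by positivity)]

theorem gaussianArea_le_entropy (x₀ : Euc (n + 1)) {t : ℝ} (ht : 0 < t)
    (μ : Measure (Euc (n + 1))) : gaussianArea x₀ t μ ≤ entropy μ :=
  le_iSup_of_le x₀ (le_iSup₂_of_le t ht le_rfl)

/-- Half of the exponent is split off. The factor `exp (-r² / (8t))` absorbs polynomial growth,
while the Gaussian at scale `2t` has integral at most the entropy. -/
theorem gaussianKernel_eq_mul (x₀ : Euc (n + 1)) {t : ℝ} (ht : 0 < t) (x : Euc (n + 1)) :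
    gaussianKernel x₀ t x = 2 ^ ((n : ℝ) / 2) * gaussianKernel x₀ (2 * t) x *
      Real.exp (-(‖x - x₀‖ ^ 2 / (8 * t))) := by
  have h1 : 4 * Real.pi * (2 * t) = 2 * (4 * Real.pi * t) := by ring
  have h2 : (0 : ℝ) < 4 * Real.pi * t := by positivity
  have h3 : -(‖x - x₀‖ ^ 2 / (4 * t)) =
      -(‖x - x₀‖ ^ 2 / (4 * (2 * t))) + -(‖x - x₀‖ ^ 2 / (8 * t)) := by
    field_simp
    ring
  rw [gaussianKernel, gaussianKernel, h1, Real.mul_rpow zero_le_two h2.le, h3, Real.exp_add]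
  have := Real.rpow_pos_of_pos (zero_lt_two (α := ℝ)) ((n : ℝ) / 2)
  have := Real.rpow_pos_of_pos h2 ((n : ℝ) / 2)
  field_simp

theorem norm_kernelField_le (x₁ : Euc (n + 1)) {s : ℝ} (hs : 0 < s) (x : Euc (n + 1)) :
    ‖kernelField x₁ s x‖ ≤ 2 ^ ((n : ℝ) / 2) * ((4 * s)⁻¹ + 2) *
      gaussianKernel (x₁ + s • eTop n) (2 * s) x := by
  have hK : 0 < gaussianKernel (x₁ + s • eTop n) (2 * s) x := gaussianKernel_pos _ (by positivity) x
  have h2 : (0 : ℝ) < 2 ^ ((n : ℝ) / 2) := by positivity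
  have hZ : ‖driftField x₁ s x‖ ≤ (2 * s)⁻¹ * ‖x - (x₁ + s • eTop n)‖ + 1 := by
    refine (norm_add_le _ _).trans ?_
    rw [norm_smul, norm_eTop, Real.norm_of_nonneg (by positivity)]
  rw [kernelField, movingKernel, norm_smul, Real.norm_of_nonneg (gaussianKernel_pos _ hs x).le,
    gaussianKernel_eq_mul _ hs]
  set r := ‖x - (x₁ + s • eTop n)‖
  -- From `exp u ≥ 1 + u` with `u = r² / (8s)` and `2r ≤ r² + 1`.
  have hexp : Real.exp (-(r ^ 2 / (8 * s))) * ((2 * s)⁻¹ * r + 1) ≤ (4 * s)⁻¹ + 2 := by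
    rw [Real.exp_neg, inv_mul_le_iff₀ (Real.exp_pos _)]
    have h3 : r ^ 2 / (8 * s) + 1 ≤ Real.exp (r ^ 2 / (8 * s)) := Real.add_one_le_exp _
    refine le_trans ?_ (mul_le_mul_of_nonneg_right h3 (by positivity))
    have h4 : (r ^ 2 / (8 * s) + 1) * ((4 * s)⁻¹ + 2) - ((2 * s)⁻¹ * r + 1) =
        r ^ 2 / (8 * s) * (4 * s)⁻¹ + (4 * s)⁻¹ * (r - 1) ^ 2 + 1 := by
      field_simp
      ring
    have : 0 ≤ r ^ 2 / (8 * s) * (4 * s)⁻¹ + (4 * s)⁻¹ * (r - 1) ^ 2 + 1 := by positivity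
    linarith
  calc _ ≤ 2 ^ ((n : ℝ) / 2) * gaussianKernel (x₁ + s • eTop n) (2 * s) x *
        Real.exp (-(r ^ 2 / (8 * s))) * ((2 * s)⁻¹ * r + 1) :=
        mul_le_mul_of_nonneg_left hZ (by positivity)
    _ = 2 ^ ((n : ℝ) / 2) * gaussianKernel (x₁ + s • eTop n) (2 * s) x *
        (Real.exp (-(r ^ 2 / (8 * s))) * ((2 * s)⁻¹ * r + 1)) := by ring
    _ ≤ 2 ^ ((n : ℝ) / 2) * gaussianKernel (x₁ + s • eTop n) (2 * s) x * ((4 * s)⁻¹ + 2) :=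
        mul_le_mul_of_nonneg_left hexp (by positivity)
    _ = _ := by ring

end GaussianBounds

/-! ### Huisken's monotonicity along the moving family. -/

section Induced

variable {n : ℕ} {M : Type*} [TopologicalSpace M] [ChartedSpace (Euc n) M]
  [MeasurableSpace M] [BorelSpace M] {f : M → Euc (n + 1)}

theorem gaussianArea_inducedMeasure (hf : Continuous f) (x₀ : Euc (n + 1)) {t : ℝ} (ht : 0 < t) :
    gaussianArea x₀ t (inducedMeasure f) =
      ∫⁻ p, ENNReal.ofReal (gaussianKernel x₀ t (f p)) ∂(riemannianVolume f) := by
  rw [gaussianArea_eq_lintegral x₀ ht, inducedMeasure, lintegral_map _ hf.measurable]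
  exact (continuous_gaussianKernel x₀ t).measurable.ennreal_ofReal

/-- On a compact set the Gaussian has a positive minimum, so finiteness of a single Gaussian area
bounds the volume by Markov's inequality. -/
theorem isFiniteMeasureOnCompacts_riemannianVolume (hf : Continuous f)
    (hfin : entropy (inducedMeasure f) < ⊤) :
    IsFiniteMeasureOnCompacts (riemannianVolume f) := by
  refine ⟨fun K hK => ?_⟩
  have hc : Continuous fun p => gaussianKernel 0 1 (f p) := (continuous_gaussianKernel 0 1).comp hf
  rcases K.eq_empty_or_nonempty with rfl | hne
  · simp
  obtain ⟨p₀, -, hp₀⟩ := hK.exists_isMinOn hne hc.continuousOn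
  have hpos : 0 < gaussianKernel 0 1 (f p₀) := gaussianKernel_pos 0 one_pos _
  have hlt : ∫⁻ p, ENNReal.ofReal (gaussianKernel 0 1 (f p)) ∂(riemannianVolume f) < ⊤ := by
    rw [← gaussianArea_inducedMeasure hf 0 one_pos]
    exact (gaussianArea_le_entropy 0 one_pos _).trans_lt hfin
  refine lt_of_le_of_lt (measure_mono fun p hp => ENNReal.ofReal_le_ofReal (hp₀ hp)) ?_
  exact (meas_ge_le_lintegral_div hc.measurable.ennreal_ofReal.aemeasurable
    (ENNReal.ofReal_pos.2 hpos).ne' ENNReal.ofReal_ne_top).trans_lt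
      (ENNReal.div_lt_top hlt.ne (ENNReal.ofReal_pos.2 hpos).ne')

theorem integrable_gaussianKernel_comp (hf : Continuous f) (hfin : entropy (inducedMeasure f) < ⊤)
    (x₀ : Euc (n + 1)) {t : ℝ} (ht : 0 < t) :
    Integrable (fun p => gaussianKernel x₀ t (f p)) (riemannianVolume f) := by
  have hc : Continuous fun p => gaussianKernel x₀ t (f p) :=
    (continuous_gaussianKernel x₀ t).comp hf
  refine ⟨hc.measurable.aestronglyMeasurable, ?_⟩
  rw [hasFiniteIntegral_iff_ofReal (ae_of_all _ fun p => (gaussianKernel_pos x₀ ht _).le),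
    ← gaussianArea_inducedMeasure hf x₀ ht]
  exact (gaussianArea_le_entropy x₀ ht _).trans_lt hfin

theorem integral_gaussianKernel_comp (hf : Continuous f)
    (x₀ : Euc (n + 1)) {t : ℝ} (ht : 0 < t) :
    ∫ p, gaussianKernel x₀ t (f p) ∂(riemannianVolume f) =
      (gaussianArea x₀ t (inducedMeasure f)).toReal := by
  rw [gaussianArea_inducedMeasure hf x₀ ht]
  exact integral_eq_lintegral_of_nonneg_ae (ae_of_all _ fun p => (gaussianKernel_pos x₀ ht _).le)
    ((continuous_gaussianKernel x₀ t).comp hf).measurable.aestronglyMeasurable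

theorem integral_norm_kernelField_le (hf : Continuous f) (hfin : entropy (inducedMeasure f) < ⊤)
    (x₁ : Euc (n + 1)) {s : ℝ} (hs : 0 < s) :
    Integrable (fun p => ‖kernelField x₁ s (f p)‖) (riemannianVolume f) ∧
      ∫ p, ‖kernelField x₁ s (f p)‖ ∂(riemannianVolume f) ≤
        2 ^ ((n : ℝ) / 2) * ((4 * s)⁻¹ + 2) * (entropy (inducedMeasure f)).toReal := by
  have hs2 : 0 < 2 * s := by positivity
  have hi := (integrable_gaussianKernel_comp hf hfin (x₁ + s • eTop n) hs2).const_mul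
    (2 ^ ((n : ℝ) / 2) * ((4 * s)⁻¹ + 2))
  have hint : Integrable (fun p => ‖kernelField x₁ s (f p)‖) (riemannianVolume f) := by
    refine hi.mono' (((contDiff_kernelField x₁ s).continuous.comp
      hf).norm.measurable.aestronglyMeasurable) (ae_of_all _ fun p => ?_)
    rw [norm_norm]
    exact norm_kernelField_le x₁ hs (f p)
  refine ⟨hint, (integral_mono hint hi fun p => norm_kernelField_le x₁ hs (f p)).trans ?_⟩
  rw [integral_const_mul, integral_gaussianKernel_comp hf _ hs2]
  refine mul_le_mul_of_nonneg_left ?_ (by positivity)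
  exact ENNReal.toReal_mono hfin.ne (gaussianArea_le_entropy _ hs2 _)

/-- Differentiation under the integral: `∂ₛ K` is bounded on the compact set `[s/2, 2s] × f (supp
η)`, and `η` vanishes elsewhere. -/
theorem hasDerivAt_integral_mul_movingKernel (hf : Continuous f)
    [IsFiniteMeasureOnCompacts (riemannianVolume f)] {η : M → ℝ} (hηc : Continuous η)
    (hηs : HasCompactSupport η) (x₁ : Euc (n + 1)) {s : ℝ} (hs : 0 < s) :
    HasDerivAt (fun s => ∫ p, η p * movingKernel x₁ s (f p) ∂(riemannianVolume f))
      (∫ p, η p * movingKernelDeriv x₁ s (f p) ∂(riemannianVolume f)) s := by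
  have hK : ∀ r, Continuous fun p => movingKernel x₁ r (f p) := fun r =>
    (continuous_gaussianKernel _ _).comp hf
  have hK' : Continuous fun p => movingKernelDeriv x₁ s (f p) := by
    have := (continuousOn_movingKernelDeriv (n := n) x₁).comp_continuous
      (f := fun p => (s, f p)) (by fun_prop) fun p => hs
    exact this
  obtain ⟨C, hC⟩ := (isCompact_Icc (a := s / 2) (b := 2 * s) |>.prod
    (hηs.isCompact.image hf)).exists_bound_of_continuousOn
      ((continuousOn_movingKernelDeriv x₁).mono fun q hq => lt_of_lt_of_le (by positivity) hq.1.1)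
  have hmem : Icc (s / 2) (2 * s) ∈ 𝓝 s := Icc_mem_nhds (by linarith) (by linarith)
  refine (hasDerivAt_integral_of_dominated_loc_of_deriv_le (bound := fun p => ‖η p‖ * C) hmem
    (Eventually.of_forall fun r => (hηc.mul (hK r)).measurable.aestronglyMeasurable)
    ((hηc.mul (hK s)).integrable_of_hasCompactSupport hηs.mul_right)
    (hηc.mul hK').measurable.aestronglyMeasurable (ae_of_all _ fun p r hr => ?_)
    ((hηc.norm.mul continuous_const).integrable_of_hasCompactSupport hηs.norm.mul_right)
    (ae_of_all _ fun p r hr =>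
      (hasDerivAt_movingKernel x₁ (lt_of_lt_of_le (by positivity) hr.1) (f p)).const_mul (η p))).2
  rw [norm_mul]
  by_cases hp : η p = 0
  · simp [hp]
  · exact mul_le_mul_of_nonneg_left
      (hC (r, f p) ⟨hr, mem_image_of_mem f (subset_tsupport η hp)⟩) (norm_nonneg _)

variable [T2Space M] [SecondCountableTopology M] [IsManifold (𝓡 n) ∞ M] {ν : M → Euc (n + 1)}

/-- Monotonicity up to an error proportional to the slope of the cutoff. The derivative in `s` is a
nonnegative square term minus the integral of `η div (K Z^T)`, which is at most `ε C`. -/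
theorem integral_mul_movingKernel_le (hf : ContMDiff (𝓡 n) 𝓘(ℝ, Euc (n + 1)) ∞ f)
    (hinj : ∀ p, Function.Injective (differential f p)) (hν : IsUnitNormal f ν)
    (hH : ∀ p, meanCurvature f ν p = -inner ℝ (ν p) (eTop n))
    (hfin : entropy (inducedMeasure f) < ⊤) (x₁ : Euc (n + 1)) {s₁ s₂ : ℝ} (hs₁ : 0 < s₁)
    (hs : s₁ ≤ s₂) {η : M → ℝ} (hηc : Continuous η) (hηs : HasCompactSupport η)
    (hη0 : ∀ p, 0 ≤ η p) {ε : ℝ} (hε : 0 ≤ ε)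
    (hη : ∀ p q, ENNReal.ofReal |η p - η q| ≤ ENNReal.ofReal ε * intrinsicEDist f p q) :
    ∫ p, η p * movingKernel x₁ s₁ (f p) ∂(riemannianVolume f) ≤
      ∫ p, η p * movingKernel x₁ s₂ (f p) ∂(riemannianVolume f) +
        ε * (2 ^ ((n : ℝ) / 2) * ((4 * s₁)⁻¹ + 2) * (entropy (inducedMeasure f)).toReal *
          (s₂ - s₁)) := by
  have hfc := hf.continuous
  have := isFiniteMeasureOnCompacts_riemannianVolume hfc hfin
  set C := 2 ^ ((n : ℝ) / 2) * ((4 * s₁)⁻¹ + 2) * (entropy (inducedMeasure f)).toReal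
  have hder : ∀ r ∈ Icc s₁ s₂, HasDerivAt
      (fun s => ∫ p, η p * movingKernel x₁ s (f p) ∂(riemannianVolume f))
      (∫ p, η p * movingKernelDeriv x₁ r (f p) ∂(riemannianVolume f)) r := fun r hr =>
    hasDerivAt_integral_mul_movingKernel hfc hηc hηs x₁ (hs₁.trans_le hr.1)
  have hge : ∀ r ∈ Icc s₁ s₂,
      -(ε * C) ≤ ∫ p, η p * movingKernelDeriv x₁ r (f p) ∂(riemannianVolume f) := by
    intro r hr
    have hr0 : 0 < r := hs₁.trans_le hr.1
    have hK : Continuous fun p => movingKernel x₁ r (f p) := (continuous_gaussianKernel _ _).comp hfc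
    have hK' : Continuous fun p => movingKernelDeriv x₁ r (f p) := by
      have := (continuousOn_movingKernelDeriv (n := n) x₁).comp_continuous
        (f := fun p => (r, f p)) (by fun_prop) fun p => hr0
      exact this
    have hq : Continuous fun p =>
        movingKernel x₁ r (f p) * inner ℝ (ν p) (driftField x₁ r (f p)) ^ 2 :=
      hK.mul ((hν.smooth.continuous.inner ((contDiff_driftField x₁ r).continuous.comp hfc)).pow 2)
    have hdiv : Continuous (tangentialDiv f ν (kernelField x₁ r)) := by
      rw [funext (tangentialDiv_kernelField hinj hν hH x₁ r)]
      exact hq.sub hK'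
    obtain ⟨hi, hle⟩ := integral_norm_kernelField_le hfc hfin x₁ hr0
    have key := (abs_le.1 (abs_integral_mul_tangentialDiv_le hf hinj hν
      ((contDiff_kernelField x₁ r).of_le (one_le_two.trans two_le_infty)) hdiv hi hηc hηs hε hη)).2
    -- The bound decreases in the scale, so its value at `s₁` serves for the whole interval.
    have hle2 : ∫ p, ‖kernelField x₁ r (f p)‖ ∂(riemannianVolume f) ≤ C := by
      refine hle.trans (mul_le_mul_of_nonneg_right ?_ ENNReal.toReal_nonneg)
      have := hr.1
      gcongr
    have hsum : ∫ p, η p * movingKernelDeriv x₁ r (f p) ∂(riemannianVolume f) =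
        ∫ p, η p * (movingKernel x₁ r (f p) * inner ℝ (ν p) (driftField x₁ r (f p)) ^ 2)
          ∂(riemannianVolume f) -
        ∫ p, η p * tangentialDiv f ν (kernelField x₁ r) p ∂(riemannianVolume f) := by
      refine Eq.trans ?_ (integral_sub ((hηc.mul hq).integrable_of_hasCompactSupport hηs.mul_right)
        ((hηc.mul hdiv).integrable_of_hasCompactSupport hηs.mul_right))
      refine integral_congr_ae (ae_of_all _ fun p => ?_)
      simp only [tangentialDiv_kernelField hinj hν hH x₁ r p]
      ring
    have hnn : 0 ≤ ∫ p, η p * (movingKernel x₁ r (f p) *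
        inner ℝ (ν p) (driftField x₁ r (f p)) ^ 2) ∂(riemannianVolume f) :=
      integral_nonneg fun p => mul_nonneg (hη0 p)
        (mul_nonneg (gaussianKernel_pos _ hr0 _).le (sq_nonneg _))
    rw [hsum]
    linarith [mul_le_mul_of_nonneg_left hle2 hε]
  have := (convex_Icc s₁ s₂).mul_sub_le_image_sub_of_le_deriv
    (fun r hr => (hder r hr).continuousAt.continuousWithinAt)
    (fun r hr => (hder r (interior_subset hr)).differentiableAt.differentiableWithinAt)
    (fun r hr => by rw [(hder r (interior_subset hr)).deriv]; exact hge r (interior_subset hr))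
    s₁ (left_mem_Icc.2 hs) s₂ (right_mem_Icc.2 hs) hs
  linarith

/-- Huisken's monotonicity formula for translaters. -/
theorem gaussianArea_moving_mono (h : IsTranslater f) (hfin : entropy (inducedMeasure f) < ⊤)
    (x₁ : Euc (n + 1)) {s₁ s₂ : ℝ} (hs₁ : 0 < s₁) (hs : s₁ ≤ s₂) :
    gaussianArea (x₁ + s₁ • eTop n) s₁ (inducedMeasure f) ≤
      gaussianArea (x₁ + s₂ • eTop n) s₂ (inducedMeasure f) := by
  obtain ⟨ν, hν, hH⟩ := h.soliton
  have hfc := h.smooth.continuous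
  have hs₂ := hs₁.trans_le hs
  have := isFiniteMeasureOnCompacts_riemannianVolume hfc hfin
  have : LocallyCompactSpace M := ChartedSpace.locallyCompactSpace (Euc n) M
  set C := 2 ^ ((n : ℝ) / 2) * ((4 * s₁)⁻¹ + 2) * (entropy (inducedMeasure f)).toReal * (s₂ - s₁)
  have hC : 0 ≤ C := mul_nonneg (by positivity) (sub_nonneg.2 hs)
  have hi₂ : Integrable (fun p => movingKernel x₁ s₂ (f p)) (riemannianVolume f) :=
    integrable_gaussianKernel_comp hfc hfin (x₁ + s₂ • eTop n) hs₂
  have hcpt : ∀ K : Set M, IsCompact K →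
      ∫⁻ p in K, ENNReal.ofReal (movingKernel x₁ s₁ (f p)) ∂(riemannianVolume f) ≤
        gaussianArea (x₁ + s₂ • eTop n) s₂ (inducedMeasure f) := by
    intro K hK
    refine ENNReal.le_of_forall_pos_le_add fun δ hδ _ => ?_
    have hδ' : (0 : ℝ) < δ := hδ
    -- This slope makes the total error at most `δ`; the summand 1 covers `C = 0`.
    obtain ⟨η, hηs, hηc, hη0, hη1, hηK, hη⟩ := exists_cutoff h.smooth h.immersion h.complete hK
      (show 0 < (δ : ℝ) / (C + 1) by positivity)
    have key := integral_mul_movingKernel_le h.smooth h.immersion hν hH hfin x₁ hs₁ hs hηc hηs hη0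
      (by positivity) hη
    have hK₁ : Continuous fun p => movingKernel x₁ s₁ (f p) :=
      (continuous_gaussianKernel _ _).comp hfc
    have hK₂ : Continuous fun p => movingKernel x₁ s₂ (f p) :=
      (continuous_gaussianKernel _ _).comp hfc
    have hη₁ := (hηc.mul hK₁).integrable_of_hasCompactSupport (μ := riemannianVolume f) hηs.mul_right
    have hη₂ := (hηc.mul hK₂).integrable_of_hasCompactSupport (μ := riemannianVolume f) hηs.mul_right
    have hle2 : ∫ p, η p * movingKernel x₁ s₂ (f p) ∂(riemannianVolume f) ≤
        ∫ p, movingKernel x₁ s₂ (f p) ∂(riemannianVolume f) :=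
      integral_mono hη₂ hi₂ fun p =>
        mul_le_of_le_one_left (gaussianKernel_pos _ hs₂ _).le (hη1 p)
    have hδC : (δ : ℝ) / (C + 1) * C ≤ δ := by
      rw [div_mul_eq_mul_div, div_le_iff₀ (by positivity)]
      exact mul_le_mul_of_nonneg_left (by linarith) hδ'.le
    calc ∫⁻ p in K, ENNReal.ofReal (movingKernel x₁ s₁ (f p)) ∂(riemannianVolume f)
        = ∫⁻ p in K, ENNReal.ofReal (η p * movingKernel x₁ s₁ (f p)) ∂(riemannianVolume f) :=
          setLIntegral_congr_fun hK.measurableSet fun p hp => by simp only [hηK p hp, one_mul]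
      _ ≤ ∫⁻ p, ENNReal.ofReal (η p * movingKernel x₁ s₁ (f p)) ∂(riemannianVolume f) :=
          setLIntegral_le_lintegral _ _
      _ = ENNReal.ofReal (∫ p, η p * movingKernel x₁ s₁ (f p) ∂(riemannianVolume f)) :=
          (ofReal_integral_eq_lintegral_ofReal hη₁ (ae_of_all _ fun p =>
            mul_nonneg (hη0 p) (gaussianKernel_pos _ hs₁ _).le)).symm
      _ ≤ ENNReal.ofReal (∫ p, movingKernel x₁ s₂ (f p) ∂(riemannianVolume f) + δ) :=
          ENNReal.ofReal_le_ofReal (by linarith)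
      _ ≤ ENNReal.ofReal (∫ p, movingKernel x₁ s₂ (f p) ∂(riemannianVolume f)) +
          ENNReal.ofReal δ := ENNReal.ofReal_add_le
      _ = _ := by
        rw [ofReal_integral_eq_lintegral_ofReal hi₂ (ae_of_all _ fun p =>
          (gaussianKernel_pos _ hs₂ _).le), gaussianArea_inducedMeasure hfc _ hs₂,
          ENNReal.ofReal_coe_nnreal]
        rfl
  -- The bound over compact sets does not depend on the set, so it passes to the union of a compact
  -- exhaustion.
  rw [gaussianArea_inducedMeasure hfc _ hs₁, ← setLIntegral_univ, ← iUnion_compactCovering M,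
    setLIntegral_iUnion_of_directed _ (Monotone.directed_le (compactCovering_subset M))]
  exact iSup_le fun i => hcpt _ (isCompact_compactCovering M i)

end Induced

/-! ### The entropy as a limit along the moving family. -/

section Entropy

variable {n : ℕ}

/-- With exponents `a` and `b` of the two kernels, `exp (-a) - exp (-b) ≤ exp (-a) (b - a)`, and
Young's inequality bounds `b - a` by `δ a` plus a term of order `‖x₁‖² / s`. Passing to the scale
`2s` leaves `exp (-a/2)`, which absorbs the factor `a`. -/
theorem movingKernel_le_add (x₁ : Euc (n + 1)) {s δ : ℝ} (hs : 0 < s) (hδ : 0 < δ)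
    (x : Euc (n + 1)) :
    movingKernel x₁ s x ≤ movingKernel 0 s x +
      2 ^ ((n : ℝ) / 2) * (2 * δ + (δ⁻¹ + 1) * ‖x₁‖ ^ 2 / (4 * s)) *
        gaussianKernel (x₁ + s • eTop n) (2 * s) x := by
  have hc : 0 < 1 / (4 * Real.pi * s) ^ ((n : ℝ) / 2) := by positivity
  set v := x - (x₁ + s • eTop n) with hv
  have hw : x - (0 + s • eTop n) = v + x₁ := by rw [hv]; abel
  set a := ‖v‖ ^ 2 / (4 * s) with ha
  set b := ‖v + x₁‖ ^ 2 / (4 * s) with hb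
  have hab : b - a ≤ δ * a + (δ⁻¹ + 1) * ‖x₁‖ ^ 2 / (4 * s) := by
    have h1 : ‖v + x₁‖ ^ 2 ≤ (‖v‖ + ‖x₁‖) ^ 2 := by
      gcongr
      exact norm_add_le _ _
    have h2 : 0 ≤ δ⁻¹ * (δ * ‖v‖ - ‖x₁‖) ^ 2 := by positivity
    have h3 : δ⁻¹ * (δ * ‖v‖ - ‖x₁‖) ^ 2 =
        δ * ‖v‖ ^ 2 - 2 * ‖v‖ * ‖x₁‖ + δ⁻¹ * ‖x₁‖ ^ 2 := by
      field_simp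
      ring
    have h4 : ‖v + x₁‖ ^ 2 - ‖v‖ ^ 2 ≤ δ * ‖v‖ ^ 2 + (δ⁻¹ + 1) * ‖x₁‖ ^ 2 := by nlinarith
    calc b - a = (‖v + x₁‖ ^ 2 - ‖v‖ ^ 2) / (4 * s) := by rw [ha, hb, sub_div]
      _ ≤ (δ * ‖v‖ ^ 2 + (δ⁻¹ + 1) * ‖x₁‖ ^ 2) / (4 * s) := by gcongr
      _ = _ := by rw [ha, add_div, mul_div_assoc]
  have hexp : Real.exp (-a) - Real.exp (-b) ≤ Real.exp (-a) * (b - a) := by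
    have h1 : Real.exp (-b) = Real.exp (-a) * Real.exp (a - b) := by
      rw [← Real.exp_add]
      congr 1
      ring
    have h2 := Real.add_one_le_exp (a - b)
    nlinarith [Real.exp_pos (-a)]
  have hK : movingKernel x₁ s x - movingKernel 0 s x ≤
      movingKernel x₁ s x * (δ * a + (δ⁻¹ + 1) * ‖x₁‖ ^ 2 / (4 * s)) := by
    have h1 : movingKernel x₁ s x = 1 / (4 * Real.pi * s) ^ ((n : ℝ) / 2) * Real.exp (-a) := rfl
    have h2 : movingKernel 0 s x = 1 / (4 * Real.pi * s) ^ ((n : ℝ) / 2) * Real.exp (-b) := by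
      rw [movingKernel, gaussianKernel, hw]
    rw [h1, h2, ← mul_sub, mul_assoc _ (Real.exp (-a))]
    exact mul_le_mul_of_nonneg_left
      (hexp.trans (mul_le_mul_of_nonneg_left hab (Real.exp_pos _).le)) hc.le
  have hG : 0 < gaussianKernel (x₁ + s • eTop n) (2 * s) x := gaussianKernel_pos _ (by positivity) x
  have hdec : movingKernel x₁ s x = 2 ^ ((n : ℝ) / 2) *
      gaussianKernel (x₁ + s • eTop n) (2 * s) x * Real.exp (-(a / 2)) := by
    rw [movingKernel, gaussianKernel_eq_mul _ hs]
    congr 3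
    rw [ha, div_div]
    congr 1
    ring
  have ha0 : 0 ≤ a := by positivity
  have hE : Real.exp (-(a / 2)) * (δ * a + (δ⁻¹ + 1) * ‖x₁‖ ^ 2 / (4 * s)) ≤
      2 * δ + (δ⁻¹ + 1) * ‖x₁‖ ^ 2 / (4 * s) := by
    have h0 : 0 ≤ (δ⁻¹ + 1) * ‖x₁‖ ^ 2 / (4 * s) := by positivity
    have h1 : Real.exp (-(a / 2)) ≤ 1 := Real.exp_le_one_iff.2 (by linarith)
    have h2 : Real.exp (-(a / 2)) * a ≤ 2 := by
      rw [Real.exp_neg, inv_mul_le_iff₀ (Real.exp_pos _)]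
      linarith [Real.add_one_le_exp (a / 2)]
    rw [mul_add]
    refine add_le_add ?_ (mul_le_of_le_one_left h0 h1)
    calc _ = Real.exp (-(a / 2)) * a * δ := by ring
      _ ≤ _ := mul_le_mul_of_nonneg_right h2 hδ.le
  have h5 : movingKernel x₁ s x * (δ * a + (δ⁻¹ + 1) * ‖x₁‖ ^ 2 / (4 * s)) ≤
      2 ^ ((n : ℝ) / 2) * (2 * δ + (δ⁻¹ + 1) * ‖x₁‖ ^ 2 / (4 * s)) *
        gaussianKernel (x₁ + s • eTop n) (2 * s) x := by
    rw [hdec]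
    calc _ = 2 ^ ((n : ℝ) / 2) * gaussianKernel (x₁ + s • eTop n) (2 * s) x *
          (Real.exp (-(a / 2)) * (δ * a + (δ⁻¹ + 1) * ‖x₁‖ ^ 2 / (4 * s))) := by ring
      _ ≤ 2 ^ ((n : ℝ) / 2) * gaussianKernel (x₁ + s • eTop n) (2 * s) x *
          (2 * δ + (δ⁻¹ + 1) * ‖x₁‖ ^ 2 / (4 * s)) := mul_le_mul_of_nonneg_left hE (by positivity)
      _ = _ := by ring
  linarith

theorem gaussianArea_shift_le (x₁ : Euc (n + 1)) {s δ : ℝ} (hs : 0 < s) (hδ : 0 < δ)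
    (μ : Measure (Euc (n + 1))) :
    gaussianArea (x₁ + s • eTop n) s μ ≤ gaussianArea (s • eTop n) s μ +
      ENNReal.ofReal (2 ^ ((n : ℝ) / 2) * (2 * δ + (δ⁻¹ + 1) * ‖x₁‖ ^ 2 / (4 * s))) * entropy μ := by
  set c := 2 ^ ((n : ℝ) / 2) * (2 * δ + (δ⁻¹ + 1) * ‖x₁‖ ^ 2 / (4 * s)) with hc
  have hc0 : 0 ≤ c := by positivity
  have hs2 : 0 < 2 * s := by positivity
  have h0 : gaussianArea (s • eTop n) s μ = ∫⁻ x, ENNReal.ofReal (movingKernel 0 s x) ∂μ := by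
    rw [gaussianArea_eq_lintegral _ hs]
    simp only [movingKernel, zero_add]
  calc gaussianArea (x₁ + s • eTop n) s μ
      = ∫⁻ x, ENNReal.ofReal (movingKernel x₁ s x) ∂μ := gaussianArea_eq_lintegral _ hs μ
    _ ≤ ∫⁻ x, (ENNReal.ofReal (movingKernel 0 s x) +
          ENNReal.ofReal c * ENNReal.ofReal (gaussianKernel (x₁ + s • eTop n) (2 * s) x)) ∂μ := by
        refine lintegral_mono fun x => ?_
        rw [← ENNReal.ofReal_mul hc0]
        exact (ENNReal.ofReal_le_ofReal (movingKernel_le_add x₁ hs hδ x)).trans ENNReal.ofReal_add_le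
    _ = gaussianArea (s • eTop n) s μ +
          ENNReal.ofReal c * gaussianArea (x₁ + s • eTop n) (2 * s) μ := by
        have hm : Measurable fun x : Euc (n + 1) => ENNReal.ofReal (movingKernel 0 s x) :=
          (continuous_gaussianKernel _ _).measurable.ennreal_ofReal
        rw [lintegral_add_left hm,
          lintegral_const_mul _ (continuous_gaussianKernel _ _).measurable.ennreal_ofReal, h0,
          gaussianArea_eq_lintegral _ hs2]
    _ ≤ _ := by
        gcongr
        exact gaussianArea_le_entropy _ hs2 μ

/-- If the Gaussian areas of `μ` are monotone along the translating families
`(x₁ + s e_{n+1}, s)`, then the entropy of `μ` is attained in the limit along the family through the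
origin. -/
theorem tendsto_gaussianArea_entropy {μ : Measure (Euc (n + 1))} (hfin : entropy μ < ⊤)
    (hmono : ∀ (x₁ : Euc (n + 1)) {s₁ s₂ : ℝ}, 0 < s₁ → s₁ ≤ s₂ →
      gaussianArea (x₁ + s₁ • eTop n) s₁ μ ≤ gaussianArea (x₁ + s₂ • eTop n) s₂ μ) :
    Tendsto (fun s : ℝ => gaussianArea (s • eTop n) s μ) atTop (𝓝 (entropy μ)) := by
  have hle : entropy μ ≤ ⨆ (s : ℝ) (_ : 0 < s), gaussianArea (s • eTop n) s μ := by
    refine ENNReal.le_of_forall_pos_le_add fun ε hε _ => ?_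
    have hε' : (0 : ℝ) < ε := hε
    refine iSup_le fun x₀ => iSup₂_le fun t₀ ht₀ => ?_
    -- The moving family through `(x₀, t₀)`.
    set x₁ := x₀ - t₀ • eTop n with hx₁
    set Λ := (entropy μ).toReal with hΛ
    have hΛ0 : 0 ≤ Λ := ENNReal.toReal_nonneg
    set A : ℝ := 2 ^ ((n : ℝ) / 2)
    have hA : 0 < A := by positivity
    -- For `s` large the error is at most `A (2δ + δ) Λ ≤ ε`; `Λ + 1` avoids division by zero.
    set δ := ε / (4 * A * (Λ + 1)) with hδ
    have hδ0 : 0 < δ := by positivity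
    have hlim : Tendsto (fun s : ℝ => (δ⁻¹ + 1) * ‖x₁‖ ^ 2 / (4 * s)) atTop (𝓝 0) :=
      (tendsto_id.const_mul_atTop (by norm_num : (0 : ℝ) < 4)).const_div_atTop _
    obtain ⟨s, hs, hst⟩ := ((hlim.eventually (ge_mem_nhds hδ0)).and
      (eventually_ge_atTop t₀)).exists
    have hs0 : 0 < s := ht₀.trans_le hst
    have hxx : x₁ + t₀ • eTop n = x₀ := by rw [hx₁]; abel
    have h1 := hmono x₁ ht₀ hst
    rw [hxx] at h1
    refine (h1.trans (gaussianArea_shift_le x₁ hs0 hδ0 μ)).trans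
      (add_le_add (le_iSup₂_of_le s hs0 le_rfl) ?_)
    rw [← ENNReal.ofReal_toReal hfin.ne, ← ENNReal.ofReal_mul (by positivity),
      ← ENNReal.ofReal_coe_nnreal]
    refine ENNReal.ofReal_le_ofReal ?_
    have h4 : 4 * A * (Λ + 1) * δ = ε := by rw [hδ]; field_simp
    calc A * (2 * δ + (δ⁻¹ + 1) * ‖x₁‖ ^ 2 / (4 * s)) * Λ ≤ A * (2 * δ + δ) * Λ := by gcongr
      _ ≤ 4 * A * (Λ + 1) * δ := by nlinarith [mul_nonneg (mul_pos hA hδ0).le hΛ0, mul_pos hA hδ0]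
      _ = ε := h4
  refine tendsto_order.2 ⟨fun a ha => ?_, fun a ha => ?_⟩
  · obtain ⟨s, h⟩ := lt_iSup_iff.1 (ha.trans_le hle)
    obtain ⟨hs, h⟩ := lt_iSup_iff.1 h
    filter_upwards [eventually_ge_atTop s] with r hr
    have := hmono 0 hs hr
    rw [zero_add, zero_add] at this
    exact h.trans_le this
  · filter_upwards [eventually_gt_atTop 0] with r hr
    exact (gaussianArea_le_entropy _ hr μ).trans_lt ha

theorem gaussianArea_add_measure (x₀ : Euc (n + 1)) (t₀ : ℝ) (μ₁ μ₂ : Measure (Euc (n + 1))) :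
    gaussianArea x₀ t₀ (μ₁ + μ₂) = gaussianArea x₀ t₀ μ₁ + gaussianArea x₀ t₀ μ₂ := by
  rw [gaussianArea, lintegral_add_measure, mul_add]
  rfl

theorem entropy_add_measure_le (μ₁ μ₂ : Measure (Euc (n + 1))) :
    entropy (μ₁ + μ₂) ≤ entropy μ₁ + entropy μ₂ := by
  refine iSup_le fun x₀ => iSup₂_le fun t₀ ht₀ => ?_
  rw [gaussianArea_add_measure]
  exact add_le_add (gaussianArea_le_entropy _ ht₀ _) (gaussianArea_le_entropy _ ht₀ _)

/-- The map `x ↦ τ⁻¹ x - τ e_{n+1}` takes the centre `τ² e_{n+1}` to the origin and the scale `τ²`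
to 1. The factor `τ⁻ⁿ` is its effect on `n`-dimensional area. -/
theorem gaussianKernel_rescale {τ : ℝ} (hτ : 0 < τ) (x : Euc (n + 1)) :
    τ⁻¹ ^ n * gaussianKernel 0 1 (τ⁻¹ • x - τ • eTop n) =
      gaussianKernel ((τ ^ 2) • eTop n) (τ ^ 2) x := by
  have h1 : τ⁻¹ • x - τ • eTop n - 0 = τ⁻¹ • (x - (τ ^ 2) • eTop n) := by
    rw [sub_zero, smul_sub, smul_smul]
    congr 2
    field_simp
  have h2 : (τ ^ 2) ^ ((n : ℝ) / 2) = τ ^ n := by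
    rw [← Real.rpow_natCast τ 2, ← Real.rpow_mul hτ.le, ← Real.rpow_natCast]
    congr 1
    push_cast
    ring
  rw [gaussianKernel, gaussianKernel, h1, norm_smul, Real.norm_of_nonneg (inv_pos.2 hτ).le,
    Real.mul_rpow (by positivity : 0 ≤ 4 * Real.pi) (sq_nonneg τ), h2, mul_one, mul_pow, inv_pow,
    inv_pow, ← mul_assoc]
  congr 1
  · rw [one_div, one_div, mul_inv, mul_comm]
  · congr 2
    field_simp

end Entropy

/-! ### The limit formula for translaters, and additivity. -/

section Translater

variable {n : ℕ} {M : Type*} [TopologicalSpace M] [ChartedSpace (Euc n) M] [IsManifold (𝓡 n) ∞ M]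
  [MeasurableSpace M] [BorelSpace M] {f : M → Euc (n + 1)}

theorem gaussianArea_inducedMeasure_rescale (hf : ContMDiff (𝓡 n) 𝓘(ℝ, Euc (n + 1)) ∞ f) {τ : ℝ}
    (hτ : 0 < τ) :
    gaussianArea 0 1 (inducedMeasure fun p => τ⁻¹ • f p - τ • eTop n) =
      gaussianArea ((τ ^ 2) • eTop n) (τ ^ 2) (inducedMeasure f) := by
  have hc := hf.continuous
  have hm : Measurable fun p => ENNReal.ofReal (gaussianKernel 0 1 (τ⁻¹ • f p - τ • eTop n)) :=
    ((continuous_gaussianKernel 0 1).measurable.comp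
      (by fun_prop : Continuous fun p => τ⁻¹ • f p - τ • eTop n).measurable).ennreal_ofReal
  rw [gaussianArea_inducedMeasure (by fun_prop) 0 one_pos,
    gaussianArea_inducedMeasure hc _ (by positivity), riemannianVolume_smul_sub hf (inv_pos.2 hτ),
    lintegral_smul_measure, smul_eq_mul, ← lintegral_const_mul _ hm]
  refine lintegral_congr fun p => ?_
  rw [← ENNReal.ofReal_mul (by positivity), gaussianKernel_rescale hτ]

variable [T2Space M] [SecondCountableTopology M]

theorem IsTranslater.tendsto_gaussianArea (h : IsTranslater f)
    (hfin : entropy (inducedMeasure f) < ⊤) :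
    Tendsto (fun s : ℝ => gaussianArea (s • eTop n) s (inducedMeasure f)) atTop
      (𝓝 (entropy (inducedMeasure f))) :=
  tendsto_gaussianArea_entropy hfin fun x₁ _ _ => gaussianArea_moving_mono h hfin x₁

theorem IsTranslater.tendsto_gaussianArea_rescale (h : IsTranslater f)
    (hfin : entropy (inducedMeasure f) < ⊤) :
    Tendsto (fun τ : ℝ => gaussianArea 0 1 (inducedMeasure fun p => τ⁻¹ • f p - τ • eTop n))
      atTop (𝓝 (entropy (inducedMeasure f))) := by
  refine ((h.tendsto_gaussianArea hfin).comp (tendsto_pow_atTop two_ne_zero)).congr' ?_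
  filter_upwards [eventually_gt_atTop 0] with τ hτ
  exact (gaussianArea_inducedMeasure_rescale h.smooth hτ).symm

end Translater

end TranslatingSoliton

end

open TranslatingSoliton in
theorem corollaryA5 {n : ℕ}
    {M₁ : Type*} [TopologicalSpace M₁] [T2Space M₁] [SecondCountableTopology M₁]
    [ChartedSpace (Euc n) M₁] [IsManifold (𝓡 n) ∞ M₁] [MeasurableSpace M₁] [BorelSpace M₁]
    {M₂ : Type*} [TopologicalSpace M₂] [T2Space M₂] [SecondCountableTopology M₂]
    [ChartedSpace (Euc n) M₂] [IsManifold (𝓡 n) ∞ M₂] [MeasurableSpace M₂] [BorelSpace M₂]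
    (f₁ : M₁ → Euc (n + 1)) (f₂ : M₂ → Euc (n + 1))
    (h₁ : IsTranslater f₁) (h₂ : IsTranslater f₂)
    (hfin₁ : entropy (inducedMeasure f₁) < ⊤) (hfin₂ : entropy (inducedMeasure f₂) < ⊤) :
    entropy (inducedMeasure f₁ + inducedMeasure f₂) =
        entropy (inducedMeasure f₁) + entropy (inducedMeasure f₂) ∧
      Tendsto (fun τ : ℝ => gaussianArea 0 1 (inducedMeasure fun p => τ⁻¹ • f₁ p - τ • eTop n))
        atTop (𝓝 (entropy (inducedMeasure f₁))) ∧
      Tendsto (fun τ : ℝ => gaussianArea 0 1 (inducedMeasure fun p => τ⁻¹ • f₂ p - τ • eTop n))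
        atTop (𝓝 (entropy (inducedMeasure f₂))) := by
  refine ⟨?_, h₁.tendsto_gaussianArea_rescale hfin₁, h₂.tendsto_gaussianArea_rescale hfin₂⟩
  have hfin : entropy (inducedMeasure f₁ + inducedMeasure f₂) < ⊤ :=
    (entropy_add_measure_le _ _).trans_lt (ENNReal.add_lt_top.2 ⟨hfin₁, hfin₂⟩)
  -- The criterion applies to the sum measure directly, since monotonicity along each moving family
  -- adds. Its entropy and the sum of the entropies are then limits of the same function.
  refine tendsto_nhds_unique (tendsto_gaussianArea_entropy hfin fun x₁ s₁ s₂ hs₁ hs => ?_)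
    (((h₁.tendsto_gaussianArea hfin₁).add (h₂.tendsto_gaussianArea hfin₂)).congr fun s =>
      (gaussianArea_add_measure _ _ _ _).symm)
  rw [gaussianArea_add_measure, gaussianArea_add_measure]
  exact add_le_add (gaussianArea_moving_mono h₁ hfin₁ x₁ hs₁ hs)
    (gaussianArea_moving_mono h₂ hfin₂ x₁ hs₁ hs)
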